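/- Let $d\ge 1$ be an integer and let $q=\frac{d}{d-1}$ (with $q=\infty$ if $d=1$). For an integer $M\ge 0$ let $D_M=\{x\in\mathbb{Z}^d: |x|_\infty\le M\}$ and $\partial D_M=\{x\in\mathbb{Z}^d: |x|_\infty=M\}$, and let $E_M$ be the set of nearest-neighbour edges of $\mathbb{Z}^d$ with both ends in $D_M$. Let $$\mathrm{Cap}_d(n)=\inf\Big\{\sum_{\langle x,y\rangle\in E_n}|f(x)-f(y)|^d \;:\; f:D_n\to\mathbb{R},\ f(0)=0,\ f(x)\ge 1\ \text{for all } x\in\partial D_n\Big\}$$ be the discrete $d$-capacity between the origin and $\partial D_n$ in the graph $(D_n,E_n)$, each undirected edge being counted once. Let $S_q^{d-1}=\{x\in\mathbb{R}^d: |x|_q=1\}$, equipped with the measure $\mathrm{d}\theta$ of the polar coordinates $x=r\theta$, $r=|x|_q$, $\theta=x/|x|_q$, that is, the measure for which $\mathrm{d}x=r^{d-1}\,\mathrm{d}r\,\mathrm{d}\theta$, and let $$\mathrm{vol}_{d-1}(S_q^{d-1})=\int_{S_q^{d-1}}\mathrm{d}\theta=d\cdot\mathrm{vol}_d\big(\{x\in\mathbb{R}^d:|x|_q\le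 1\}\big)$$ be its total mass. Then, as $n\to\infty$ along the integers, $$\mathrm{Cap}_d(n)\sim\frac{\mathrm{vol}_{d-1}(S_q^{d-1})}{(\log n)^{d-1}},$$ i.e. the ratio of the two sides tends to $1$. -/

import Mathlib

open Filter Asymptotics MeasureTheory

/-- The `p`-Dirichlet energy `∑_{e = ⟨x, y⟩ ∈ E} |f x - f y| ^ p` of a function on the vertices of a
finite graph. Each undirected edge is counted once. -/
noncomputable def pEnergy {V : Type*} [Fintype V] (G : SimpleGraph V) (p : ℝ) (f : V → ℝ) : ℝ :=
  open scoped Classical in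
  ∑ e ∈ G.edgeFinset,
    Sym2.lift ⟨fun x y => |f x - f y| ^ p, fun x y => by simp only [abs_sub_comm]⟩ e

/-- The `p`-capacity between two sets `A` and `B` of vertices of a finite graph: the infimum of the
`p`-Dirichlet energy over all real functions with `f ≥ 1` on `B` and `f = 0` on `A`. -/
noncomputable def pCapacity {V : Type*} [Fintype V] (G : SimpleGraph V) (p : ℝ) (A B : Set V) : ℝ :=
  sInf {E : ℝ | ∃ f : V → ℝ, (∀ x ∈ B, 1 ≤ f x) ∧ (∀ x ∈ A, f x = 0) ∧ E = pEnergy G p f}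

/-- The nearest-neighbour graph on `ℤ^d`: `x ∼ y` if and only if `|x - y|_1 = 1`. -/
def latticeGraph (d : ℕ) : SimpleGraph (Fin d → ℤ) where
  Adj x y := ∑ i, |x i - y i| = 1
  symm := ⟨fun x y h => by simpa only [abs_sub_comm] using h⟩
  loopless := ⟨fun x h => by simp at h⟩

/-- The box `D_M = {x ∈ ℤ^d : |x|_∞ ≤ M}`; the norm on a function space `Fin d → ℤ` is the
sup norm. -/
def latticeBox (d M : ℕ) : Set (Fin d → ℤ) := {x | ‖x‖ ≤ M}

theorem latticeBox_finite (d M : ℕ) : (latticeBox d M).Finite := by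
  have h : latticeBox d M = Metric.closedBall (0 : Fin d → ℤ) M := by
    ext x; simp [latticeBox]
  rw [h]
  exact (isCompact_closedBall _ _).finite_of_discrete

noncomputable instance latticeBoxFintype (d M : ℕ) : Fintype (latticeBox d M) :=
  (latticeBox_finite d M).fintype

/-- `Cap_{d,p}(n)`: the `p`-capacity between the origin and the boundary `{|x|_∞ = n}` in the
graph `(D_n, E_n)`, where `E_n` is the set of edges of `ℤ^d` with both ends in `D_n`. -/
noncomputable def boxCapacity (d : ℕ) (p : ℝ) (n : ℕ) : ℝ :=
  pCapacity ((latticeGraph d).induce (latticeBox d n)) p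
    {x | (x : Fin d → ℤ) = 0} {x | ‖(x : Fin d → ℤ)‖ = n}

/-- The exponent `q = d / (d - 1)`, with `q = ∞` if `d = 1`. -/
noncomputable def dualExponent (d : ℕ) : ENNReal := (d : ENNReal) / ((d : ENNReal) - 1)

instance dualExponent_fact (d : ℕ) [NeZero d] : Fact (1 ≤ dualExponent d) := by
  refine ⟨?_⟩
  have h0 : (d : ENNReal) ≠ 0 := by exact_mod_cast NeZero.ne d
  rw [dualExponent, ENNReal.le_div_iff_mul_le (Or.inr h0) (Or.inr (ENNReal.natCast_ne_top d)),
    one_mul]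
  exact tsub_le_self

/-- `ℝ^d` with the norm `|x|_q`, `q = d / (d - 1)`. -/
abbrev LqSpace (d : ℕ) : Type := PiLp (dualExponent d) (fun _ : Fin d => ℝ)

/-- Lebesgue measure on `ℝ^d`, carried over to `LqSpace d` by the identity map. -/
noncomputable def lebesgueLq (d : ℕ) : Measure (LqSpace d) :=
  Measure.map (WithLp.toLp (dualExponent d)) (volume : Measure (Fin d → ℝ))

/-- The measure `dθ` on the sphere `S_q^{d-1} = {x ∈ ℝ^d : |x|_q = 1}` of the polar coordinates
`x = r θ`, `r = |x|_q > 0`, `θ = x / |x|_q ∈ S_q^{d-1}`, that is, the measure for which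
`dx = r^{d-1} dr dθ`. It gives a Borel set `A` the mass `d · vol_d {r θ : 0 < r < 1, θ ∈ A}`. -/
noncomputable def sphereMeasure (d : ℕ) [NeZero d] :
    Measure (Metric.sphere (0 : LqSpace d) 1) :=
  (lebesgueLq d).toSphere

/-- `vol_{d-1}(S_q^{d-1})`, the total mass of `dθ`. -/
noncomputable def sphereVol (d : ℕ) [NeZero d] : ℝ := (sphereMeasure d).real Set.univ

/-! The exponents `d` and `q = d / (d - 1)` are conjugate, so the gradient of `|x|_q` has `ℓ^d` norm
1. The continuum problem of minimising `∫ ∑ |∂_i u|^d` over a shell `a < |x|_q < b` is therefore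
solved by the function affine in `log |x|_q`, with energy `V / log (b / a) ^ (d - 1)`, where `V` is
the mass of the sphere. Constant factors in `a` and `b` are lost in the asymptotics of the
logarithm, so only a crude comparison of radii is needed when passing between the lattice and the
continuum. The constant `V` itself must survive exactly.

Lower bound. Extend an admissible `F` to the box by multilinear interpolation. Its partial
derivatives are combinations of edge increments with nonnegative weights. Each weight has integral 1
(`lintegral_edgeWeight`), so spreading `|increment|^d` with these weights gives a density whose
integral is the energy. At each point the weights in a given direction sum to at most 1
(`sum_edgeWeight_le_one`). A linearised Hölder inequality bounds this density below by the radial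
derivative (`le_energyDensity_smul`). Integrating along each ray, where the interpolation climbs
from 0 to at least 1, and then over the sphere gives the bound (`le_integral_ray`,
`sphereVol_mul_le_energy`). Near the origin `1 / r` is not integrable, so radii below a fixed `ε`
are discarded. The loss is small because the increments may be assumed bounded.

Upper bound. Test with the averages over unit cubes of the logarithmic profile. By Jensen's
inequality the discrete energy of the averages is at most the continuum energy
(`sum_enorm_edgeDiff_cubeAverage_le`), which polar coordinates evaluate
(`sum_lintegral_logProfileGrad_le`). -/

/-! ### The discrete energy as a sum over oriented edges -/

/-- The points of the box of radius `n`, as a finset. -/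
noncomputable def boxFinset (d n : ℕ) : Finset (Fin d → ℤ) :=
  Fintype.piFinset fun _ => Finset.Icc (-(n : ℤ)) n

theorem mem_boxFinset {d n : ℕ} {z : Fin d → ℤ} :
    z ∈ boxFinset d n ↔ ∀ i, -(n : ℤ) ≤ z i ∧ z i ≤ n := by
  simp [boxFinset]

theorem mem_latticeBox_iff {d n : ℕ} {z : Fin d → ℤ} :
    z ∈ latticeBox d n ↔ z ∈ boxFinset d n := by
  rw [mem_boxFinset, latticeBox, Set.mem_ofPred_eq, pi_norm_le_iff_of_nonneg (by positivity)]
  refine forall_congr' fun i => ?_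
  rw [Int.norm_eq_abs, abs_le]
  norm_cast

/-- The edges of the box, as pairs `(i, z)` standing for the edge from `z` to `z + e_i`. -/
noncomputable def boxEdges (d n : ℕ) : Finset (Fin d × (Fin d → ℤ)) :=
  (Finset.univ ×ˢ boxFinset d n).filter fun e => e.2 + Pi.single e.1 1 ∈ boxFinset d n

theorem mem_boxEdges {d n : ℕ} {e : Fin d × (Fin d → ℤ)} :
    e ∈ boxEdges d n ↔ e.2 ∈ boxFinset d n ∧ e.2 + Pi.single e.1 1 ∈ boxFinset d n := by
  simp [boxEdges]

theorem latticeGraph_adj_add_single {d : ℕ} (z : Fin d → ℤ) (i : Fin d) :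
    (latticeGraph d).Adj z (z + Pi.single i 1) := by
  change ∑ j, |z j - (z + Pi.single i 1 : Fin d → ℤ) j| = 1
  rw [Finset.sum_eq_single i]
  · simp
  · intro j _ hj; simp [Pi.single_eq_of_ne hj]
  · simp

theorem exists_of_latticeGraph_adj {d : ℕ} {x y : Fin d → ℤ} (h : (latticeGraph d).Adj x y) :
    ∃ i, y = x + Pi.single i 1 ∨ x = y + Pi.single i 1 := by
  change ∑ j, |x j - y j| = 1 at h
  obtain ⟨i, hi⟩ : ∃ i, x i ≠ y i := by
    by_contra! hc
    simp [hc] at h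
  have h1 : |x i - y i| + ∑ j ∈ Finset.univ.erase i, |x j - y j| = 1 := by
    rw [← h, Finset.add_sum_erase _ (fun j => |x j - y j|) (Finset.mem_univ i)]
  have h2 : 0 ≤ ∑ j ∈ Finset.univ.erase i, |x j - y j| := Finset.sum_nonneg fun _ _ => abs_nonneg _
  have h3 : 1 ≤ |x i - y i| := Int.one_le_abs (sub_ne_zero.mpr hi)
  have h4 : ∑ j ∈ Finset.univ.erase i, |x j - y j| = 0 := by omega
  have h5 : ∀ j, j ≠ i → x j = y j := fun j hj => by
    have := (Finset.sum_eq_zero_iff_of_nonneg (fun _ _ => abs_nonneg _)).1 h4 j (by simp [hj])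
    rwa [abs_eq_zero, sub_eq_zero] at this
  have h6 : |x i - y i| = 1 := by omega
  refine ⟨i, ?_⟩
  rcases (abs_eq (by norm_num)).1 h6 with h7 | h7
  · right
    ext j
    by_cases hj : j = i
    · subst hj; simp; omega
    · simp [Pi.single_eq_of_ne hj, h5 j hj]
  · left
    ext j
    by_cases hj : j = i
    · subst hj; simp; omega
    · simp [Pi.single_eq_of_ne hj, h5 j hj]

/-- Every undirected edge has exactly one orientation in which a coordinate increases, so it is
counted once by its lower end and its direction. -/
theorem pEnergy_box_eq {d n : ℕ} (p : ℝ) (F : (Fin d → ℤ) → ℝ) :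
    pEnergy ((latticeGraph d).induce (latticeBox d n)) p (fun x => F x) =
      ∑ e ∈ boxEdges d n, |F (e.2 + Pi.single e.1 1) - F e.2| ^ p := by
  classical
  unfold pEnergy
  symm
  refine Finset.sum_bij (fun e he => s(⟨e.2, mem_latticeBox_iff.2 (mem_boxEdges.1 he).1⟩,
    ⟨e.2 + Pi.single e.1 1, mem_latticeBox_iff.2 (mem_boxEdges.1 he).2⟩)) ?_ ?_ ?_ ?_
  · intro e he
    simp only [SimpleGraph.mem_edgeFinset, SimpleGraph.mem_edgeSet, SimpleGraph.comap_adj]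
    exact latticeGraph_adj_add_single _ _
  · rintro ⟨i, z⟩ hz ⟨j, y⟩ hy h
    simp only [Sym2.eq_iff, Subtype.mk.injEq] at h
    rcases h with ⟨h1, h2⟩ | ⟨h1, h2⟩
    · subst h1
      have h3 : (Pi.single i 1 : Fin d → ℤ) = Pi.single j 1 := by simpa using h2
      have h4 : i = j := by
        by_contra hij
        have := congrFun h3 i
        simp [Pi.single_eq_of_ne hij] at this
      rw [h4]
    · exfalso
      subst h1
      have h3 := congrFun h2 i
      by_cases hij : i = j
      · subst hij; simp at h3; omega
      · simp [Pi.single_eq_of_ne hij] at h3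
  · intro b hb
    induction b using Sym2.ind with
    | _ x y =>
      obtain ⟨x, hx⟩ := x
      obtain ⟨y, hy⟩ := y
      simp only [SimpleGraph.mem_edgeFinset, SimpleGraph.mem_edgeSet, SimpleGraph.comap_adj] at hb
      obtain ⟨i, h | h⟩ := exists_of_latticeGraph_adj hb
      · simp only [Function.Embedding.subtype_apply] at h
        subst h
        exact ⟨(i, x), mem_boxEdges.2 ⟨mem_latticeBox_iff.1 hx, mem_latticeBox_iff.1 hy⟩, rfl⟩
      · simp only [Function.Embedding.subtype_apply] at h
        subst h
        exact ⟨(i, y), mem_boxEdges.2 ⟨mem_latticeBox_iff.1 hy, mem_latticeBox_iff.1 hx⟩,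
          Sym2.eq_swap⟩
  · intro e he
    simp only [Sym2.lift_mk]
    rw [abs_sub_comm]

/-- The capacity of the box is at most any admissible energy. -/
theorem boxCapacity_le {d n : ℕ} (F : (Fin d → ℤ) → ℝ) (h0 : F 0 = 0)
    (h1 : ∀ z : Fin d → ℤ, ‖z‖ = n → 1 ≤ F z) :
    boxCapacity d d n ≤ ∑ e ∈ boxEdges d n, |F (e.2 + Pi.single e.1 1) - F e.2| ^ d := by
  unfold boxCapacity pCapacity
  refine csInf_le ⟨0, ?_⟩ ⟨fun x => F x, fun x hx => h1 _ hx, fun x hx => ?_, ?_⟩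
  · rintro _ ⟨f, -, -, rfl⟩
    refine Finset.sum_nonneg fun e _ => ?_
    induction e using Sym2.ind with
    | _ x y => exact Real.rpow_nonneg (abs_nonneg _) _
  · rw [Set.mem_ofPred_eq] at hx
    simp only [hx, h0]
  · rw [pEnergy_box_eq]
    simp only [Real.rpow_natCast]

/-- A common lower bound of the admissible energies is a lower bound of the capacity. -/
theorem le_boxCapacity {d n : ℕ} (hn : n ≠ 0) (c : ℝ)
    (h : ∀ F : (Fin d → ℤ) → ℝ, F 0 = 0 → (∀ z : Fin d → ℤ, ‖z‖ = n → 1 ≤ F z) →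
      c ≤ ∑ e ∈ boxEdges d n, |F (e.2 + Pi.single e.1 1) - F e.2| ^ d) :
    c ≤ boxCapacity d d n := by
  classical
  unfold boxCapacity pCapacity
  refine le_csInf ?_ ?_
  -- The sup norm is admissible once `n ≥ 1`. Without an admissible function the infimum would be
  -- the default value 0.
  · refine ⟨_, fun x => ‖(x : Fin d → ℤ)‖, fun x hx => ?_, fun x hx => ?_, rfl⟩
    · rw [Set.mem_ofPred_eq] at hx
      simp only [hx]
      exact_mod_cast Nat.one_le_iff_ne_zero.2 hn
    · rw [Set.mem_ofPred_eq] at hx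
      simp only [hx, norm_zero]
  · rintro _ ⟨f, hf1, hf0, rfl⟩
    set F : (Fin d → ℤ) → ℝ := fun z => if hz : z ∈ latticeBox d n then f ⟨z, hz⟩ else 0 with hF
    have hfF : f = fun x : latticeBox d n => F x := by
      ext ⟨x, hx⟩
      simp [hF, hx]
    have hmem : ∀ z : Fin d → ℤ, ‖z‖ ≤ n → z ∈ latticeBox d n := fun z hz => hz
    have := h F ?_ ?_
    · rw [hfF, pEnergy_box_eq]
      simpa only [Real.rpow_natCast] using this
    · have h0 : (0 : Fin d → ℤ) ∈ latticeBox d n := hmem 0 (by simp)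
      simp only [hF, h0, dite_true]
      exact hf0 _ rfl
    · intro z hz
      have h0 : z ∈ latticeBox d n := hmem z hz.le
      simp only [hF, h0, dite_true]
      exact hf1 _ hz

/-! ### The norm `|x|_q` and its gradient -/

/-- The norm `|x|_q`, `q = d / (d - 1)`, on `Fin d → ℝ`. -/
noncomputable def qNorm {d : ℕ} (x : Fin d → ℝ) : ℝ := ‖(WithLp.toLp (dualExponent d) x : LqSpace d)‖

/-- The absolute values `(|x i| / |x|_q) ^ (1 / (d - 1))` of the partial derivatives of `|x|_q`. -/
noncomputable def qGrad {d : ℕ} (x : Fin d → ℝ) (i : Fin d) : ℝ :=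
  (|x i| / qNorm x) ^ (1 / ((d : ℝ) - 1))

theorem toReal_dualExponent {d : ℕ} (hd : 2 ≤ d) :
    (dualExponent d).toReal = (d : ℝ) / ((d : ℝ) - 1) := by
  rw [dualExponent, ENNReal.toReal_div, ENNReal.toReal_sub_of_le]
  · simp
  · exact_mod_cast (by omega : 1 ≤ d)
  · simp

section
variable {d : ℕ} [NeZero d]

omit [NeZero d] in
theorem qNorm_eq_sum (hd : 2 ≤ d) (x : Fin d → ℝ) :
    qNorm x = (∑ i, |x i| ^ ((d : ℝ) / ((d : ℝ) - 1))) ^ (((d : ℝ) - 1) / d) := by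
  have hd' : (2 : ℝ) ≤ d := by exact_mod_cast hd
  have h : 0 < (dualExponent d).toReal := by
    rw [toReal_dualExponent hd]; exact div_pos (by linarith) (by linarith)
  rw [qNorm, PiLp.norm_eq_sum h]
  simp [toReal_dualExponent hd]

theorem qNorm_nonneg (x : Fin d → ℝ) : 0 ≤ qNorm x := norm_nonneg _

theorem abs_le_qNorm (x : Fin d → ℝ) (i : Fin d) : |x i| ≤ qNorm x := 
  PiLp.norm_apply_le (WithLp.toLp (dualExponent d) x : LqSpace d) i

theorem norm_le_qNorm (x : Fin d → ℝ) : ‖x‖ ≤ qNorm x :=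
  (pi_norm_le_iff_of_nonneg (qNorm_nonneg x)).2 fun i => abs_le_qNorm x i

theorem qNorm_smul (r : ℝ) (x : Fin d → ℝ) : qNorm (r • x) = |r| * qNorm x := by
  rw [qNorm, WithLp.toLp_smul, norm_smul]; rfl

/-- The constant `d` is not sharp, but it enters the capacity bounds only inside logarithms. -/
theorem qNorm_le (x : Fin d → ℝ) : qNorm x ≤ d * ‖x‖ := by
  have h : (WithLp.toLp (dualExponent d) x : LqSpace d) =
      ∑ i, x i • WithLp.toLp (dualExponent d) (Pi.single i (1 : ℝ)) := by
    ext j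
    simp [Pi.single_apply]
  rw [qNorm, h]
  refine (norm_sum_le _ _).trans ?_
  calc ∑ i, ‖x i • (WithLp.toLp (dualExponent d) (Pi.single i (1 : ℝ)) : LqSpace d)‖
      ≤ ∑ _i : Fin d, ‖x‖ := by
        refine Finset.sum_le_sum fun i _ => ?_
        rw [norm_smul, PiLp.toLp_single, PiLp.norm_single]
        simpa using norm_le_pi_norm x i
    _ = d * ‖x‖ := by simp

theorem continuous_qNorm : Continuous (qNorm : (Fin d → ℝ) → ℝ) :=
  continuous_norm.comp (PiLp.continuous_toLp _ _)

theorem qNorm_one (hd : d = 1) (x : Fin d → ℝ) (i : Fin d) : qNorm x = |x i| := by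
  refine le_antisymm ((qNorm_le x).trans_eq ?_) (abs_le_qNorm x i)
  subst hd
  have : x = fun _ => x i := by ext j; rw [Subsingleton.elim i j]
  rw [this, pi_norm_const]
  simp

theorem qGrad_nonneg (x : Fin d → ℝ) (i : Fin d) : 0 ≤ qGrad x i :=
  Real.rpow_nonneg (div_nonneg (abs_nonneg _) (qNorm_nonneg _)) _

/-- This is the equality case of Hölder's inequality between `ℓ^q` and `ℓ^d`. For `d = 1` the
exponent `1 / (d - 1)` is 0 by the convention on division, so `qGrad` is 1, which is the right value
there. -/
theorem qGrad_pow_sub_one (x : Fin d → ℝ) (hx : qNorm x ≠ 0) (i : Fin d) :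
    qGrad x i ^ (d - 1) = |x i| / qNorm x := by
  rcases eq_or_ne d 1 with rfl | hd
  · rw [qNorm_one rfl x i] at *
    simp [div_self hx]
  · have h2 : 2 ≤ d := by have := NeZero.ne d; omega
    have hd' : (2 : ℝ) ≤ d := by exact_mod_cast h2
    rw [qGrad, ← Real.rpow_natCast, ← Real.rpow_mul (div_nonneg (abs_nonneg _) (qNorm_nonneg _)),
      Nat.cast_sub (by omega), Nat.cast_one, one_div, inv_mul_cancel₀ (by linarith), Real.rpow_one]

omit [NeZero d] in
theorem sum_abs_rpow_eq (hd : 2 ≤ d) (x : Fin d → ℝ) :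
    ∑ i, |x i| ^ ((d : ℝ) / ((d : ℝ) - 1)) = qNorm x ^ ((d : ℝ) / ((d : ℝ) - 1)) := by
  have hd' : (2 : ℝ) ≤ d := by exact_mod_cast hd
  rw [qNorm_eq_sum hd, ← Real.rpow_mul (Finset.sum_nonneg fun i _ => by positivity)]
  rw [div_mul_div_cancel₀ (by linarith), div_self (by linarith), Real.rpow_one]

/-- The gradient of a norm has dual norm 1. In both bounds this is what makes the constant exactly
the mass of the sphere. -/
theorem sum_qGrad_pow (x : Fin d → ℝ) (hx : qNorm x ≠ 0) : ∑ i, qGrad x i ^ d = 1 := by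
  rcases eq_or_ne d 1 with rfl | hd
  · simp only [qGrad]; simp
  · have h2 : 2 ≤ d := by have := NeZero.ne d; omega
    have hd' : (2 : ℝ) ≤ d := by exact_mod_cast h2
    have h : ∀ i, qGrad x i ^ d =
        |x i| ^ ((d : ℝ) / ((d : ℝ) - 1)) / qNorm x ^ ((d : ℝ) / ((d : ℝ) - 1)) := fun i => by
      rw [qGrad, ← Real.rpow_natCast,
        ← Real.rpow_mul (div_nonneg (abs_nonneg _) (qNorm_nonneg _)), one_div_mul_eq_div,
        Real.div_rpow (abs_nonneg _) (qNorm_nonneg _)]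
    simp only [h]
    rw [← Finset.sum_div, sum_abs_rpow_eq h2, div_self]
    exact (Real.rpow_pos_of_pos (lt_of_le_of_ne (qNorm_nonneg x) hx.symm) _).ne'

/-- The norm along a coordinate line determines the absolute value of the coordinate. -/
theorem abs_eq_of_qNorm_update_eq (x : Fin d → ℝ) (i : Fin d) {s t : ℝ}
    (h : qNorm (Function.update x i s) = qNorm (Function.update x i t)) : |s| = |t| := by
  rcases eq_or_ne d 1 with hd | hd
  · rw [qNorm_one hd _ i, qNorm_one hd _ i] at h
    simpa using h
  · have h2 : 2 ≤ d := by have := NeZero.ne d; omega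
    have hd' : (2 : ℝ) ≤ d := by exact_mod_cast h2
    have h3 := sum_abs_rpow_eq h2 (Function.update x i s)
    rw [h, ← sum_abs_rpow_eq h2 (Function.update x i t), ← Finset.add_sum_erase _ _ (Finset.mem_univ i),
      ← Finset.add_sum_erase _ _ (Finset.mem_univ i)] at h3
    have h4 : ∑ j ∈ Finset.univ.erase i, |Function.update x i s j| ^ ((d : ℝ) / ((d : ℝ) - 1)) =
        ∑ j ∈ Finset.univ.erase i, |Function.update x i t j| ^ ((d : ℝ) / ((d : ℝ) - 1)) := by
      refine Finset.sum_congr rfl fun j hj => ?_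
      rw [Function.update_of_ne (Finset.ne_of_mem_erase hj),
        Function.update_of_ne (Finset.ne_of_mem_erase hj)]
    rw [h4] at h3
    simp only [Function.update_self, add_left_inj] at h3
    exact (Real.rpow_left_inj (abs_nonneg _) (abs_nonneg _)
      (div_pos (by linarith) (by linarith)).ne').1 h3

theorem hasDerivAt_qNorm_update (x : Fin d → ℝ) (i : Fin d) {t : ℝ} (ht : t ≠ 0) :
    HasDerivAt (fun s => qNorm (Function.update x i s))
      (SignType.sign t * qGrad (Function.update x i t) i) t := by
  have habs := hasDerivAt_abs ht
  rcases eq_or_ne d 1 with hd | hd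
  · have h : (fun s => qNorm (Function.update x i s)) = fun s => |s| := by
      ext s; rw [qNorm_one hd _ i]; simp
    rw [h]
    convert habs using 1
    subst hd
    simp [qGrad]
  · have h2 : 2 ≤ d := by have := NeZero.ne d; omega
    have hd' : (2 : ℝ) ≤ d := by exact_mod_cast h2
    set q : ℝ := (d : ℝ) / ((d : ℝ) - 1) with hq
    have hq0 : 0 < q := div_pos (by linarith) (by linarith)
    have hq1 : q - 1 = 1 / ((d : ℝ) - 1) := by
      rw [hq, div_sub_one (by linarith)]; congr 1; ring
    set A := ∑ j ∈ Finset.univ.erase i, |x j| ^ q with hA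
    have hA0 : 0 ≤ A := Finset.sum_nonneg fun j _ => by positivity
    have h : ∀ s, qNorm (Function.update x i s) = (|s| ^ q + A) ^ (1 / q) := fun s => by
      rw [qNorm_eq_sum h2, ← Finset.add_sum_erase _ _ (Finset.mem_univ i), Function.update_self, hA,
        hq, one_div_div]
      congr 2
      refine Finset.sum_congr rfl fun j hj => ?_
      rw [Function.update_of_ne (Finset.ne_of_mem_erase hj)]
    have hN := h t
    rw [funext h]
    have ht' : 0 < |t| := abs_pos.2 ht
    have hb : 0 < |t| ^ q + A := by positivity
    have hd1 := ((habs.rpow_const (p := q) (Or.inl ht'.ne')).add_const A).rpow_const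
      (p := 1 / q) (Or.inl hb.ne')
    convert hd1 using 1
    rw [qGrad, Function.update_self, hN, ← hq1, Real.div_rpow ht'.le (by positivity),
      ← Real.rpow_mul hb.le]
    have e : (|t| ^ q + A) ^ (1 / q - 1) = ((|t| ^ q + A) ^ (1 / q * (q - 1)))⁻¹ := by
      rw [← Real.rpow_neg hb.le]; congr 1; field_simp; ring
    rw [e]
    field_simp

/-! ### Polar coordinates for `|x|_q` -/

instance : (lebesgueLq d).IsAddHaarMeasure :=
  (PiLp.continuousLinearEquiv (dualExponent d) ℝ (fun _ : Fin d => ℝ)).symm.isAddHaarMeasure_map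
    volume

omit [NeZero d] in
theorem finrank_LqSpace : Module.finrank ℝ (LqSpace d) = d := by
  rw [(PiLp.continuousLinearEquiv (dualExponent d) ℝ (fun _ : Fin d => ℝ)).toLinearEquiv.finrank_eq]
  simp

instance : Nontrivial (LqSpace d) :=
  Module.nontrivial_of_finrank_pos (R := ℝ) (by rw [finrank_LqSpace]; exact NeZero.pos d)

instance : IsFiniteMeasure (sphereMeasure d) := by unfold sphereMeasure; infer_instance

theorem sphereVol_pos : 0 < sphereVol d := by
  rw [sphereVol, measureReal_def, ENNReal.toReal_pos_iff]
  refine ⟨?_, measure_lt_top _ _⟩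
  rw [Measure.measure_univ_pos, sphereMeasure]
  exact Measure.toSphere_ne_zero _

theorem ofReal_sphereVol : ENNReal.ofReal (sphereVol d) = sphereMeasure d Set.univ := by
  rw [sphereVol, ofReal_measureReal]

/-- Integration in polar coordinates of the norm `|x|_q`. -/
theorem lintegral_eq_lintegral_sphere {h : (Fin d → ℝ) → ENNReal} (hh : Measurable h) :
    ∫⁻ x, h x = ∫⁻ θ, (∫⁻ r in Set.Ioi (0 : ℝ),
      ENNReal.ofReal (r ^ (d - 1)) * h (r • (θ : LqSpace d).ofLp)) ∂sphereMeasure d := by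
  set H : LqSpace d → ENNReal := fun y => h y.ofLp with hH
  have hHm : Measurable H := hh.comp (WithLp.measurable_ofLp _ _)
  have h1 : ∫⁻ x, h x = ∫⁻ y, H y ∂lebesgueLq d := by
    rw [lebesgueLq, lintegral_map hHm (WithLp.measurable_toLp _ _)]
  have h2 : ∫⁻ y, H y ∂lebesgueLq d =
      ∫⁻ y : ({0}ᶜ : Set (LqSpace d)), H y ∂(lebesgueLq d).comap (↑) := by
    rw [lintegral_subtype_comap (measurableSet_singleton _).compl, restrict_compl_singleton]
  have h3 := (lebesgueLq d).measurePreserving_homeomorphUnitSphereProd.lintegral_comp_emb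
    (Homeomorph.measurableEmbedding _) (fun p => H ((p.2 : ℝ) • (p.1 : LqSpace d)))
  have hm : Measurable (fun p : Metric.sphere (0 : LqSpace d) 1 × Set.Ioi (0 : ℝ) =>
      H ((p.2 : ℝ) • (p.1 : LqSpace d))) := by
    refine hHm.comp (Continuous.measurable ?_)
    fun_prop
  rw [lintegral_prod _ hm.aemeasurable] at h3
  rw [h1, h2, sphereMeasure]
  refine Eq.trans ?_ (h3.trans ?_)
  · refine lintegral_congr fun y => ?_
    have hy : (y : LqSpace d) ≠ 0 := y.2
    simp [smul_smul, mul_inv_cancel₀ (norm_ne_zero_iff.2 hy)]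
  · refine lintegral_congr fun θ => ?_
    rw [finrank_LqSpace, Measure.volumeIoiPow, lintegral_withDensity_eq_lintegral_mul _ (by fun_prop)
      (by exact hm.comp measurable_prodMk_left)]
    exact lintegral_subtype_comap measurableSet_Ioi
      (fun r : ℝ => ENNReal.ofReal (r ^ (d - 1)) * H (r • (θ : LqSpace d)))
end

/-! ### Hat functions and multilinear interpolation -/

/-- The hat function `max 0 (1 - |t|)`. -/
noncomputable def hat (t : ℝ) : ℝ := max 0 (1 - |t|)

/-- The indicator function of `[0, 1)`. -/
noncomputable def unitStep (t : ℝ) : ℝ := (Set.Ico (0 : ℝ) 1).indicator 1 t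

theorem hat_nonneg (t : ℝ) : 0 ≤ hat t := le_max_left _ _

theorem unitStep_nonneg (t : ℝ) : 0 ≤ unitStep t := Set.indicator_nonneg (fun _ _ => zero_le_one) _

theorem unitStep_of_mem {t : ℝ} (h0 : 0 ≤ t) (h1 : t < 1) : unitStep t = 1 :=
  Set.indicator_of_mem (s := Set.Ico (0 : ℝ) 1) ⟨h0, h1⟩ _

theorem unitStep_of_neg {t : ℝ} (h : t < 0) : unitStep t = 0 :=
  Set.indicator_of_notMem (s := Set.Ico (0 : ℝ) 1) (fun h' => h.not_ge h'.1) _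

theorem unitStep_of_one_le {t : ℝ} (h : 1 ≤ t) : unitStep t = 0 :=
  Set.indicator_of_notMem (s := Set.Ico (0 : ℝ) 1) (fun h' => h.not_gt h'.2) _

theorem hat_eq_zero {t : ℝ} (h : 1 ≤ |t|) : hat t = 0 := max_eq_left (by linarith)

theorem continuous_hat : Continuous hat := by unfold hat; fun_prop

theorem measurable_unitStep : Measurable unitStep :=
  measurable_one.indicator measurableSet_Ico

/-- Writing the slope as a difference of two translates of one function prepares the summation by
parts that turns vertex values into edge increments. -/
theorem hasDerivAt_hat {t : ℝ} (h0 : t ≠ 0) (h1 : t ≠ 1) (h2 : t ≠ -1) :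
    HasDerivAt hat (unitStep (t + 1) - unitStep t) t := by
  have hc : ∀ {c : ℝ} {f : ℝ → ℝ}, HasDerivAt f c t → f =ᶠ[nhds t] hat → HasDerivAt hat c t :=
    fun hf he => hf.congr_of_eventuallyEq he.symm
  rcases lt_or_gt_of_ne h2 with h | h
  · rw [unitStep_of_neg (by linarith), unitStep_of_neg (by linarith), sub_zero]
    refine hc (hasDerivAt_const t (0 : ℝ)) ?_
    filter_upwards [eventually_lt_nhds h] with s hs
    rw [hat_eq_zero]; rw [abs_of_neg (by linarith)]; linarith
  rcases lt_or_gt_of_ne h0 with h' | h'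
  · rw [unitStep_of_mem (by linarith) (by linarith), unitStep_of_neg (by linarith), sub_zero]
    refine hc ((hasDerivAt_id t).const_add 1) ?_
    filter_upwards [eventually_lt_nhds h', eventually_gt_nhds h] with s hs hs'
    rw [hat, abs_of_neg hs, max_eq_right (by linarith)]; simp
  rcases lt_or_gt_of_ne h1 with h'' | h''
  · rw [unitStep_of_one_le (by linarith), unitStep_of_mem (by linarith) (by linarith), zero_sub]
    refine hc ((hasDerivAt_id t).const_sub 1) ?_
    filter_upwards [eventually_lt_nhds h'', eventually_gt_nhds h'] with s hs hs'
    rw [hat, abs_of_pos hs', max_eq_right (by linarith)]; simp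
  · rw [unitStep_of_one_le (by linarith), unitStep_of_one_le (by linarith), sub_zero]
    refine hc (hasDerivAt_const t (0 : ℝ)) ?_
    filter_upwards [eventually_gt_nhds h''] with s hs
    rw [hat_eq_zero]; rw [abs_of_pos (by linarith)]; linarith

theorem integrable_unitStep : Integrable unitStep :=
  (integrable_indicator_iff measurableSet_Ico).2 (by
    refine integrableOn_const (C := (1 : ℝ)) ?_
    simp)

theorem integral_unitStep : ∫ t, unitStep t = 1 := by
  change ∫ t, (Set.Ico (0 : ℝ) 1).indicator 1 t = 1
  rw [integral_indicator_one measurableSet_Ico]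
  simp

theorem support_hat_subset : Function.support hat ⊆ Set.Ioc (-1 : ℝ) 1 := fun t ht => by
  have : |t| < 1 := by
    by_contra! hc
    exact ht (hat_eq_zero hc)
  rw [abs_lt] at this
  exact ⟨this.1, this.2.le⟩

theorem integrable_hat : Integrable hat :=
  continuous_hat.integrable_of_hasCompactSupport
    (HasCompactSupport.intro isCompact_Icc (K := Set.Icc (-1) 1) fun t ht => by
      by_contra hc
      exact ht (Set.Ioc_subset_Icc_self (support_hat_subset hc)))

theorem integral_hat : ∫ t, hat t = 1 := by
  have hi : ∀ a b : ℝ, IntervalIntegrable hat volume a b := fun a b =>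
    continuous_hat.intervalIntegrable a b
  rw [← intervalIntegral.integral_eq_integral_of_support_subset support_hat_subset,
    ← intervalIntegral.integral_add_adjacent_intervals (hi (-1) 0) (hi 0 1)]
  have e1 : ∫ t in (-1 : ℝ)..0, hat t = ∫ t in (-1 : ℝ)..0, (1 + t) := by
    refine intervalIntegral.integral_congr fun t ht => ?_
    rw [Set.uIcc_of_le (by norm_num)] at ht
    simp only [hat]
    rw [abs_of_nonpos ht.2, max_eq_right (by linarith [ht.1])]; ring
  have e2 : ∫ t in (0 : ℝ)..1, hat t = ∫ t in (0 : ℝ)..1, (1 - t) := by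
    refine intervalIntegral.integral_congr fun t ht => ?_
    rw [Set.uIcc_of_le (by norm_num)] at ht
    simp only [hat]
    rw [abs_of_nonneg ht.1, max_eq_right (by linarith [ht.2])]
  rw [e1, e2, intervalIntegral.integral_add (by simp) (by simp),
    intervalIntegral.integral_sub (by simp) (by simp)]
  norm_num

theorem sum_unitStep_le_one (n : ℕ) (t : ℝ) :
    ∑ m ∈ Finset.Icc (-(n : ℤ)) n, unitStep (t - m) ≤ 1 := by
  have : ∀ m : ℤ, unitStep (t - m) = if m = ⌊t⌋ then 1 else 0 := fun m => by
    by_cases h : m = ⌊t⌋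
    · rw [if_pos h, h, unitStep_of_mem] <;> linarith [Int.floor_le t, Int.lt_floor_add_one t]
    · rw [if_neg h]
      by_contra hc
      have hm := Set.mem_of_indicator_ne_zero (s := Set.Ico (0 : ℝ) 1) hc
      exact h (Int.floor_eq_iff.2 ⟨by linarith [hm.1], by linarith [hm.2]⟩).symm
  simp only [this, Finset.sum_ite_eq']
  split_ifs <;> norm_num

theorem sum_hat_pair (t : ℝ) : hat (t - ⌊t⌋) + hat (t - (⌊t⌋ + 1 : ℤ)) = 1 := by
  have h1 := Int.floor_le t
  have h2 := Int.lt_floor_add_one t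
  push_cast
  rw [hat, hat, abs_of_nonneg (by linarith), abs_of_nonpos (by linarith), max_eq_right (by linarith),
    max_eq_right (by linarith)]
  ring

theorem hat_sub_int_eq_zero {t : ℝ} {m : ℤ} (h : m ∉ ({⌊t⌋, ⌊t⌋ + 1} : Finset ℤ)) :
    hat (t - m) = 0 := by
  have h1 := Int.floor_le t
  have h2 := Int.lt_floor_add_one t
  simp only [Finset.mem_insert, Finset.mem_singleton, not_or] at h
  refine hat_eq_zero ?_
  rcases lt_or_gt_of_ne h.1 with h3 | h3
  · have : (m : ℝ) + 1 ≤ ⌊t⌋ := by exact_mod_cast h3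
    rw [abs_of_nonneg] <;> linarith
  · have h4 : ⌊t⌋ + 2 ≤ m := by have := h.2; omega
    have : (⌊t⌋ : ℝ) + 2 ≤ m := by exact_mod_cast h4
    rw [abs_of_nonpos] <;> linarith

theorem sum_hat_le_one (n : ℕ) (t : ℝ) :
    ∑ m ∈ Finset.Icc (-(n : ℤ)) n, hat (t - m) ≤ 1 := by
  have hne : ⌊t⌋ ∉ ({⌊t⌋ + 1} : Finset ℤ) := by simp
  calc ∑ m ∈ Finset.Icc (-(n : ℤ)) n, hat (t - m)
      ≤ ∑ m ∈ Finset.Icc (-(n : ℤ)) n ∪ {⌊t⌋, ⌊t⌋ + 1}, hat (t - m) :=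
        Finset.sum_le_sum_of_subset_of_nonneg Finset.subset_union_left fun _ _ _ => hat_nonneg _
    _ = ∑ m ∈ {⌊t⌋, ⌊t⌋ + 1}, hat (t - m) :=
        (Finset.sum_subset Finset.subset_union_right fun m _ hm => hat_sub_int_eq_zero hm).symm
    _ = 1 := by rw [Finset.sum_insert hne, Finset.sum_singleton, sum_hat_pair]

theorem sum_hat_eq_one {n : ℕ} {t : ℝ} (ht : |t| ≤ n) :
    ∑ m ∈ Finset.Icc (-(n : ℤ)) n, hat (t - m) = 1 := by
  rw [abs_le] at ht
  have hne : ⌊t⌋ ∉ ({⌊t⌋ + 1} : Finset ℤ) := by simp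
  have e : ∑ m ∈ Finset.Icc (-(n : ℤ)) n ∪ {⌊t⌋, ⌊t⌋ + 1}, hat (t - m) = 1 := by
    rw [← Finset.sum_subset Finset.subset_union_right fun m _ hm => hat_sub_int_eq_zero hm,
      Finset.sum_insert hne, Finset.sum_singleton, sum_hat_pair]
  rw [← e]
  refine Finset.sum_subset Finset.subset_union_left fun m hm hm' => ?_
  have h1 : -(n : ℤ) ≤ ⌊t⌋ := Int.le_floor.2 (by push_cast; linarith)
  have h2 : ⌊t⌋ ≤ n := by exact_mod_cast (Int.floor_le t).trans ht.2
  simp only [Finset.mem_union, Finset.mem_insert, Finset.mem_singleton, Finset.mem_Icc] at hm hm'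
  -- The only neighbour of `t` that can leave the range is `n + 1`, when `t = n`, and its hat
  -- vanishes there.
  have h3 : (n : ℤ) + 1 ≤ m := by omega
  have h4 : (n : ℝ) + 1 ≤ m := by exact_mod_cast h3
  exact hat_eq_zero (by rw [abs_of_nonpos] <;> linarith)

section
variable {d : ℕ}

/-- The multilinear interpolation of a function on the points of the box. -/
noncomputable def interp (n : ℕ) (F : (Fin d → ℤ) → ℝ) (x : Fin d → ℝ) : ℝ :=
  ∑ z ∈ boxFinset d n, F z * ∏ j, hat (x j - z j)

/-- The coefficient of the edge `e` in the gradient of the multilinear interpolation. -/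
noncomputable def edgeWeight (e : Fin d × (Fin d → ℤ)) (x : Fin d → ℝ) : ℝ :=
  ∏ j, (if j = e.1 then unitStep else hat) (x j - e.2 j)

/-- The increment of `F` along the edge `e`. -/
def edgeDiff (F : (Fin d → ℤ) → ℝ) (e : Fin d × (Fin d → ℤ)) : ℝ :=
  F (e.2 + Pi.single e.1 1) - F e.2

theorem edgeWeight_nonneg (e : Fin d × (Fin d → ℤ)) (x : Fin d → ℝ) : 0 ≤ edgeWeight e x :=
  Finset.prod_nonneg fun j _ => by
    split_ifs
    exacts [unitStep_nonneg _, hat_nonneg _]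

theorem measurable_edgeWeight (e : Fin d × (Fin d → ℤ)) : Measurable (edgeWeight e) := by
  unfold edgeWeight
  refine Finset.measurable_fun_prod _ fun j _ => ?_
  have : Measurable (if j = e.1 then unitStep else hat) := by
    split_ifs
    exacts [measurable_unitStep, continuous_hat.measurable]
  exact this.comp (by fun_prop)

theorem edgeWeight_eq (e : Fin d × (Fin d → ℤ)) (x : Fin d → ℝ) :
    edgeWeight e x =
      unitStep (x e.1 - e.2 e.1) * ∏ j ∈ Finset.univ.erase e.1, hat (x j - e.2 j) := by
  rw [edgeWeight, ← Finset.mul_prod_erase _ _ (Finset.mem_univ e.1), if_pos rfl]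
  congr 1
  exact Finset.prod_congr rfl fun j hj => by rw [if_neg (Finset.ne_of_mem_erase hj)]

/-- The weight is a product of one-variable functions of integral 1. This normalisation makes the
energy density integrate to the energy with no loss. -/
theorem lintegral_edgeWeight (e : Fin d × (Fin d → ℤ)) :
    ∫⁻ x, ENNReal.ofReal (edgeWeight e x) = 1 := by
  have h1 : ∀ j : Fin d, Integrable (if j = e.1 then unitStep else hat) := fun j => by
    split_ifs
    exacts [integrable_unitStep, integrable_hat]
  have h2 : ∀ j : Fin d, ∫ t, (if j = e.1 then unitStep else hat) t = 1 := fun j => by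
    split_ifs
    exacts [integral_unitStep, integral_hat]
  have h3 : Integrable (edgeWeight e) :=
    Integrable.fintype_prod (f := fun j t => (if j = e.1 then unitStep else hat) (t - e.2 j))
      fun j => (h1 j).comp_sub_right _
  rw [← ofReal_integral_eq_lintegral_ofReal h3 (Eventually.of_forall (edgeWeight_nonneg e))]
  have h4 : ∫ x, edgeWeight e x = 1 := by
    refine (integral_fintype_prod_volume_eq_prod
      (fun j t => (if j = e.1 then unitStep else hat) (t - e.2 j))).trans ?_
    refine Finset.prod_eq_one fun j _ => ?_
    rw [integral_sub_right_eq_self (fun t => (if j = e.1 then unitStep else hat) t), h2]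
  rw [h4, ENNReal.ofReal_one]

/-- The sum over the box of a product factors into one-dimensional sums, each at most 1 because hats
and unit steps are partitions of unity over all of `ℤ`. -/
theorem sum_edgeWeight_le_one (n : ℕ) (i : Fin d) (x : Fin d → ℝ) :
    ∑ z ∈ boxFinset d n, edgeWeight (i, z) x ≤ 1 := by
  simp only [edgeWeight, boxFinset]
  rw [← Finset.prod_univ_sum (fun _ => Finset.Icc (-(n : ℤ)) n)
    (fun j m => (if j = i then unitStep else hat) (x j - m))]
  refine Finset.prod_le_one (fun j _ => Finset.sum_nonneg fun m _ => ?_) fun j _ => ?_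
  · split_ifs
    exacts [unitStep_nonneg _, hat_nonneg _]
  · split_ifs
    exacts [sum_unitStep_le_one n _, sum_hat_le_one n _]

theorem sum_boxEdges_eq {M : Type*} [AddCommMonoid M] (n : ℕ)
    (a : Fin d × (Fin d → ℤ) → M) :
    ∑ e ∈ boxEdges d n, a e = ∑ i, ∑ z ∈ (boxFinset d n).filter
      (fun z => z + Pi.single i 1 ∈ boxFinset d n), a (i, z) := by
  rw [boxEdges, Finset.sum_filter, Finset.sum_product]
  simp only [Finset.sum_filter]

theorem sum_edgeWeight_mul_le (n : ℕ) (x c : Fin d → ℝ) (hc : ∀ i, 0 ≤ c i) :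
    ∑ e ∈ boxEdges d n, edgeWeight e x * c e.1 ≤ ∑ i, c i := by
  rw [sum_boxEdges_eq]
  refine Finset.sum_le_sum fun i _ => ?_
  simp only
  rw [← Finset.sum_mul]
  refine mul_le_of_le_one_left (hc i) ((Finset.sum_le_sum_of_subset_of_nonneg
    (Finset.filter_subset _ _) fun z _ _ => edgeWeight_nonneg _ x).trans
    (sum_edgeWeight_le_one n i x))

theorem continuous_interp (n : ℕ) (F : (Fin d → ℤ) → ℝ) : Continuous (interp n F) := by
  unfold interp
  have := continuous_hat
  fun_prop

theorem interp_zero (n : ℕ) {F : (Fin d → ℤ) → ℝ} (h0 : F 0 = 0) : interp n F 0 = 0 := by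
  refine Finset.sum_eq_zero fun z _ => ?_
  by_cases hz : z = 0
  · simp [hz, h0]
  · obtain ⟨j, hj⟩ := Function.ne_iff.1 hz
    rw [Finset.prod_eq_zero (Finset.mem_univ j), mul_zero]
    refine hat_eq_zero ?_
    have : 1 ≤ |z j| := Int.one_le_abs hj
    simpa using (by exact_mod_cast this : (1 : ℝ) ≤ |(z j : ℝ)|)

/-- On a face of the cube the interpolation is a convex combination of values of `F` on the same
face: if `|x i| = n`, a lattice point of the box with nonzero hat must satisfy `z i = x i`. -/
theorem one_le_interp {n : ℕ} {F : (Fin d → ℤ) → ℝ}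
    (h1 : ∀ z : Fin d → ℤ, ‖z‖ = n → 1 ≤ F z) {x : Fin d → ℝ} (hx : ∀ j, |x j| ≤ n)
    {i : Fin d} (hi : |x i| = n) : 1 ≤ interp n F x := by
  have hs : ∑ z ∈ boxFinset d n, ∏ j, hat (x j - z j) = 1 := by
    rw [boxFinset, ← Finset.prod_univ_sum (fun _ => Finset.Icc (-(n : ℤ)) n)
      (fun j m => hat (x j - m))]
    exact Finset.prod_eq_one fun j _ => sum_hat_eq_one (hx j)
  rw [← hs, interp]
  refine Finset.sum_le_sum fun z hz => ?_
  by_cases hp : ∏ j, hat (x j - z j) = 0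
  · rw [hp, mul_zero]
  · refine le_mul_of_one_le_left (Finset.prod_nonneg fun j _ => hat_nonneg _) (h1 z ?_)
    have h2 : |x i - z i| < 1 := by
      by_contra! hc
      exact hp (Finset.prod_eq_zero (Finset.mem_univ i) (hat_eq_zero hc))
    have h3 : |z i| = n := by
      rcases (abs_eq (by positivity)).1 hi with h | h
      · rw [h, abs_lt] at h2
        have h4 : (n : ℤ) < z i + 1 := by
          have : (n : ℝ) < z i + 1 := by linarith [h2.2]
          exact_mod_cast this
        have h5 := mem_boxFinset.1 hz i
        rw [abs_of_nonneg] <;> omega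
      · rw [h, abs_lt] at h2
        have h4 : z i < -(n : ℤ) + 1 := by
          have : (z i : ℝ) < -n + 1 := by linarith [h2.1]
          exact_mod_cast this
        have h5 := mem_boxFinset.1 hz i
        rw [abs_of_nonpos] <;> omega
    refine le_antisymm (mem_latticeBox_iff.2 hz) ?_
    calc (n : ℝ) = ‖z i‖ := by rw [Int.norm_eq_abs]; exact_mod_cast h3.symm
      _ ≤ ‖z‖ := norm_le_pi_norm z i

theorem add_single_mem_boxFinset_iff {n : ℕ} {z : Fin d → ℤ} (hz : z ∈ boxFinset d n) (i : Fin d) :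
    z + Pi.single i 1 ∈ boxFinset d n ↔ z i + 1 ≤ n := by
  rw [mem_boxFinset] at *
  refine ⟨fun h => by simpa using (h i).2, fun h j => ?_⟩
  by_cases hj : j = i
  · subst hj; simp; have := hz j; omega
  · simpa [Pi.single_eq_of_ne hj] using hz j

/-- Summation by parts for the derivative of the interpolation in a coordinate direction. -/
theorem sum_mul_unitStep_sub {n : ℕ} (F : (Fin d → ℤ) → ℝ) (i : Fin d) {x : Fin d → ℝ}
    (hx : |x i| < n) :
    ∑ z ∈ boxFinset d n, F z * ((∏ j ∈ Finset.univ.erase i, hat (x j - z j)) *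
        (unitStep (x i - z i + 1) - unitStep (x i - z i))) =
      ∑ z ∈ (boxFinset d n).filter (fun z => z + Pi.single i 1 ∈ boxFinset d n),
        edgeDiff F (i, z) * edgeWeight (i, z) x := by
  rw [abs_lt] at hx
  simp only [edgeDiff, edgeWeight_eq, sub_mul, mul_sub, Finset.sum_sub_distrib]
  congr 1
  · symm
    -- Shifting by the unit vector carries lower ends of edges onto the points with `z i ≥ -n + 1`.
    -- The face `z i = -n` left over contributes nothing, since `x i + n + 1 ≥ 1`.
    rw [← Finset.sum_filter_of_ne (s := boxFinset d n) (p := fun z => -(n : ℤ) + 1 ≤ z i)]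
    · refine Finset.sum_bij' (fun z _ => z + Pi.single i 1) (fun z _ => z - Pi.single i 1) ?_ ?_
        (fun z _ => by simp) (fun z _ => by simp) ?_
      · intro z hz
        rw [Finset.mem_filter] at hz ⊢
        refine ⟨hz.2, ?_⟩
        have := mem_boxFinset.1 hz.1 i
        simp; omega
      · intro z hz
        rw [Finset.mem_filter] at hz ⊢
        refine ⟨?_, by simpa using hz.1⟩
        rw [mem_boxFinset] at *
        intro j
        by_cases hj : j = i
        · subst hj; simp; have := hz.1 j; omega
        · simpa [Pi.single_eq_of_ne hj] using hz.1 j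
      · intro z hz
        have e : ∏ j ∈ Finset.univ.erase i, hat (x j - ((z + Pi.single i 1 : Fin d → ℤ) j : ℤ)) =
            ∏ j ∈ Finset.univ.erase i, hat (x j - z j) :=
          Finset.prod_congr rfl fun j hj => by
            simp [Pi.single_eq_of_ne (Finset.ne_of_mem_erase hj)]
        rw [e]
        have e2 : x i - ((z + Pi.single i 1 : Fin d → ℤ) i : ℤ) + 1 = x i - z i := by simp; ring
        rw [e2]
        ring
    · intro z hz h
      by_contra hc
      have h1 := (mem_boxFinset.1 hz i).1
      have h2 : z i = -n := by omega
      refine h ?_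
      rw [unitStep_of_one_le, mul_zero, mul_zero]
      rw [h2]; push_cast; linarith
  · symm
    refine (Finset.sum_congr rfl fun z _ => by ring).trans (Finset.sum_filter_of_ne fun z hz h => ?_)
    by_contra hc
    rw [add_single_mem_boxFinset_iff hz] at hc
    have h1 : z i = n := by have := (mem_boxFinset.1 hz i).2; omega
    refine h ?_
    rw [unitStep_of_neg, mul_zero, mul_zero]
    rw [h1]; push_cast; linarith

/-- The kinks of the interpolation lie on lattice hyperplanes. A coordinate with `θ i = 0` stays
constant along the ray and needs no condition. -/
theorem hasDerivAt_interp_smul {n : ℕ} (F : (Fin d → ℤ) → ℝ) (θ : Fin d → ℝ) {r : ℝ}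
    (hr : ∀ i, |r * θ i| < n) (hz : ∀ i, θ i ≠ 0 → ∀ m : ℤ, r * θ i ≠ m) :
    HasDerivAt (fun r => interp n F (r • θ))
      (∑ e ∈ boxEdges d n, θ e.1 * (edgeDiff F e * edgeWeight e (r • θ))) r := by
  have h1 : ∀ (i : Fin d) (m : ℤ), HasDerivAt (fun r => hat (r * θ i - m))
      ((unitStep (r * θ i - m + 1) - unitStep (r * θ i - m)) * θ i) r := fun i m => by
    by_cases hi : θ i = 0
    · simp only [hi, mul_zero]
      exact hasDerivAt_const r _
    · have hb : HasDerivAt (fun r => r * θ i - m) (θ i) r := by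
        simpa using ((hasDerivAt_id r).mul_const (θ i)).sub_const (m : ℝ)
      refine HasDerivAt.comp (h₂ := hat) r (hasDerivAt_hat ?_ ?_ ?_) hb
      · exact fun h => hz i hi m (by linarith)
      · exact fun h => hz i hi (m + 1) (by push_cast; linarith)
      · exact fun h => hz i hi (m - 1) (by push_cast; linarith)
  have h2 := HasDerivAt.fun_sum (u := boxFinset d n) fun z _ =>
    (HasDerivAt.fun_finsetProd (u := Finset.univ) fun i _ => h1 i (z i)).const_mul (F z)
  refine h2.congr_deriv ?_
  simp only [smul_eq_mul, Finset.mul_sum]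
  rw [Finset.sum_comm, sum_boxEdges_eq]
  refine Finset.sum_congr rfl fun i _ => ?_
  simp only
  rw [← Finset.mul_sum, ← sum_mul_unitStep_sub F i (x := r • θ) (by simpa using hr i), Finset.mul_sum]
  refine Finset.sum_congr rfl fun z _ => ?_
  simp only [Pi.smul_apply, smul_eq_mul]
  ring
end

/-! ### Lower bound: energy along rays -/

/-- The tangent line inequality for the power function. -/
theorem mul_pow_sub_le_pow (k : ℕ) {s t : ℝ} (hs : 0 ≤ s) (ht : 0 ≤ t) :
    (k + 1) * s ^ k * t - k * s ^ (k + 1) ≤ t ^ (k + 1) := by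
  induction k with
  | zero => simp
  | succ k ih =>
    have h1 : 0 ≤ t * (t ^ (k + 1) - ((k + 1) * s ^ k * t - k * s ^ (k + 1))) :=
      mul_nonneg ht (by linarith)
    have h2 : 0 ≤ (k + 1) * s ^ k * (t - s) ^ 2 := by positivity
    push_cast
    have e : t ^ (k + 1 + 1) - ((k + 1 + 1) * s ^ (k + 1) * t - (k + 1) * s ^ (k + 1 + 1)) =
      t * (t ^ (k + 1) - ((k + 1) * s ^ k * t - k * s ^ (k + 1))) +
        (k + 1) * s ^ k * (t - s) ^ 2 := by ring
    linarith

section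
variable {d : ℕ}

/-- A density on `ℝ^d` whose integral is the energy of `F`. -/
noncomputable def energyDensity (n : ℕ) (F : (Fin d → ℤ) → ℝ) (x : Fin d → ℝ) : ℝ :=
  ∑ e ∈ boxEdges d n, edgeWeight e x * |edgeDiff F e| ^ d

theorem energyDensity_nonneg (n : ℕ) (F : (Fin d → ℤ) → ℝ) (x : Fin d → ℝ) :
    0 ≤ energyDensity n F x :=
  Finset.sum_nonneg fun e _ => mul_nonneg (edgeWeight_nonneg e x) (by positivity)

theorem measurable_energyDensity (n : ℕ) (F : (Fin d → ℤ) → ℝ) :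
    Measurable (energyDensity n F) :=
  Finset.measurable_fun_sum _ fun e _ => (measurable_edgeWeight e).mul_const _

theorem lintegral_energyDensity (n : ℕ) (F : (Fin d → ℤ) → ℝ) :
    ∫⁻ x, ENNReal.ofReal (energyDensity n F x) =
      ENNReal.ofReal (∑ e ∈ boxEdges d n, |edgeDiff F e| ^ d) := by
  have h : ∀ x, ENNReal.ofReal (energyDensity n F x) =
      ∑ e ∈ boxEdges d n, ENNReal.ofReal (edgeWeight e x) * ENNReal.ofReal (|edgeDiff F e| ^ d) :=
    fun x => by
      rw [energyDensity, ENNReal.ofReal_sum_of_nonneg fun e _ =>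
        mul_nonneg (edgeWeight_nonneg e x) (by positivity)]
      exact Finset.sum_congr rfl fun e _ => ENNReal.ofReal_mul (edgeWeight_nonneg e x)
  simp only [h]
  rw [lintegral_finsetSum _ fun e _ => (measurable_edgeWeight e).ennreal_ofReal.mul_const _,
    ENNReal.ofReal_sum_of_nonneg fun e _ => by positivity]
  refine Finset.sum_congr rfl fun e _ => ?_
  rw [lintegral_mul_const _ (measurable_edgeWeight e).ennreal_ofReal, lintegral_edgeWeight, one_mul]

/-- The derivative of the interpolation of `F` along a ray. -/
noncomputable def rayDeriv (n : ℕ) (F : (Fin d → ℤ) → ℝ) (θ : Fin d → ℝ) (r : ℝ) : ℝ :=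
  ∑ e ∈ boxEdges d n, θ e.1 * (edgeDiff F e * edgeWeight e (r • θ))

theorem measurable_rayDeriv (n : ℕ) (F : (Fin d → ℤ) → ℝ) (θ : Fin d → ℝ) :
    Measurable (rayDeriv n F θ) :=
  Finset.measurable_fun_sum _ fun e _ =>
    (((measurable_edgeWeight e).comp (by fun_prop)).const_mul _).const_mul _

variable [NeZero d]

theorem abs_rayDeriv_le {n : ℕ} {F : (Fin d → ℤ) → ℝ} {θ : Fin d → ℝ} (hθ : qNorm θ = 1) {K : ℝ}
    (hK0 : 0 ≤ K) (hK : ∀ e ∈ boxEdges d n, |edgeDiff F e| ≤ K) (r : ℝ) :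
    |rayDeriv n F θ r| ≤ d * K := by
  calc |rayDeriv n F θ r| ≤ ∑ e ∈ boxEdges d n, |θ e.1 * (edgeDiff F e * edgeWeight e (r • θ))| :=
        Finset.abs_sum_le_sum_abs _ _
    _ ≤ ∑ e ∈ boxEdges d n, edgeWeight e (r • θ) * (fun _ => K) e.1 := by
        refine Finset.sum_le_sum fun e he => ?_
        rw [abs_mul, abs_mul, abs_of_nonneg (edgeWeight_nonneg e _)]
        have h1 : |θ e.1| ≤ 1 := (abs_le_qNorm θ e.1).trans hθ.le
        calc |θ e.1| * (|edgeDiff F e| * edgeWeight e (r • θ))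
            ≤ 1 * (K * edgeWeight e (r • θ)) := by
              gcongr
              · exact mul_nonneg (abs_nonneg _) (edgeWeight_nonneg e _)
              · exact edgeWeight_nonneg e _
              · exact hK e he
          _ = _ := by ring
    _ ≤ ∑ _i : Fin d, K := sum_edgeWeight_mul_le n _ _ fun _ => hK0
    _ = d * K := by simp

theorem intervalIntegrable_of_bounded {f : ℝ → ℝ} (hf : Measurable f) {C : ℝ}
    (hC : ∀ r, |f r| ≤ C) (a b : ℝ) : IntervalIntegrable f volume a b := by
  rw [intervalIntegrable_iff]
  exact Measure.integrableOn_of_bounded (M := C) (by simp) hf.aestronglyMeasurable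
    (Eventually.of_forall hC)

omit [NeZero d] in
theorem energyDensity_le {n : ℕ} {F : (Fin d → ℤ) → ℝ} {K : ℝ}
    (hK0 : 0 ≤ K) (hK : ∀ e ∈ boxEdges d n, |edgeDiff F e| ≤ K) (x : Fin d → ℝ) :
    energyDensity n F x ≤ d * K ^ d := by
  calc energyDensity n F x ≤ ∑ e ∈ boxEdges d n, edgeWeight e x * (fun _ => K ^ d) e.1 := by
        refine Finset.sum_le_sum fun e he => mul_le_mul_of_nonneg_left ?_ (edgeWeight_nonneg e x)
        exact pow_le_pow_left₀ (abs_nonneg _) (hK e he) d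
    _ ≤ ∑ _i : Fin d, K ^ d := sum_edgeWeight_mul_le n _ _ fun _ => pow_nonneg hK0 d
    _ = d * K ^ d := by simp

omit [NeZero d] in
theorem intervalIntegrable_energyDensity_smul {n : ℕ} {F : (Fin d → ℤ) → ℝ} {K : ℝ}
    (hK0 : 0 ≤ K) (hK : ∀ e ∈ boxEdges d n, |edgeDiff F e| ≤ K) (θ : Fin d → ℝ) (a b : ℝ) :
    IntervalIntegrable (fun r => r ^ (d - 1) * energyDensity n F (r • θ)) volume a b := by
  refine (intervalIntegrable_of_bounded (C := d * K ^ d)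
    ((measurable_energyDensity n F).comp (by fun_prop)) (fun r => ?_) a b).continuousOn_mul
      (by fun_prop)
  simp only [Function.comp]
  rw [abs_of_nonneg (energyDensity_nonneg n F _)]
  exact energyDensity_le hK0 hK _

theorem integral_rayDeriv {n : ℕ} {F : (Fin d → ℤ) → ℝ} {θ : Fin d → ℝ} (hθ : qNorm θ = 1) {K : ℝ}
    (hK0 : 0 ≤ K) (hK : ∀ e ∈ boxEdges d n, |edgeDiff F e| ≤ K) :
    ∫ r in (0 : ℝ)..(n / ‖θ‖), rayDeriv n F θ r =
      interp n F ((n / ‖θ‖) • θ) - interp n F 0 := by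
  -- The ray leaves the box at radius `n / ‖θ‖`. It crosses lattice hyperplanes, where
  -- differentiability may fail, only at the countably many radii `m / θ i`.
  have h := integral_eq_of_hasDerivAt_off_countable_of_le (fun r : ℝ => interp n F (r • θ))
    (rayDeriv n F θ) (a := 0) (b := n / ‖θ‖) (by positivity)
    (s := ⋃ i, ⋃ m : ℤ, {(m : ℝ) / θ i})
    (Set.countable_iUnion fun i => Set.countable_iUnion fun m => Set.countable_singleton _)
    ((continuous_interp n F).comp (by fun_prop)).continuousOn ?_
    (intervalIntegrable_of_bounded (measurable_rayDeriv n F θ)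
      (abs_rayDeriv_le hθ hK0 hK) _ _)
  · rw [h, zero_smul]
  · rintro r ⟨⟨hr0, hr1⟩, hr⟩
    refine hasDerivAt_interp_smul F θ (fun i => ?_) fun i hi m hm => hr ?_
    · rw [abs_mul, abs_of_pos hr0]
      have hpos : 0 < ‖θ‖ := by
        by_contra hc
        have : ‖θ‖ = 0 := le_antisymm (not_lt.1 hc) (norm_nonneg _)
        rw [this, div_zero] at hr1
        linarith
      calc r * |θ i| ≤ r * ‖θ‖ := by
            gcongr
            exact norm_le_pi_norm θ i
        _ < n := (lt_div_iff₀ hpos).1 hr1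
    · simp only [Set.mem_iUnion, Set.mem_singleton_iff]
      exact ⟨i, m, by rw [eq_div_iff hi, hm]⟩

/-- This is Hölder's inequality linearised around the optimal profile `c log r`. The result is
linear in the radial derivative, so it can be integrated directly along the ray. -/
theorem le_energyDensity_smul {n : ℕ} (F : (Fin d → ℤ) → ℝ) {θ : Fin d → ℝ} (hθ : qNorm θ = 1)
    {c r : ℝ} (hc : 0 ≤ c) (hr : 0 < r) :
    d * c ^ (d - 1) * rayDeriv n F θ r - (d - 1) * c ^ d * r⁻¹ ≤
      r ^ (d - 1) * energyDensity n F (r • θ) := by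
  obtain ⟨k, rfl⟩ : ∃ k, d = k + 1 := ⟨d - 1, by have := NeZero.ne d; omega⟩
  simp only [Nat.add_sub_cancel, Nat.cast_add, Nat.cast_one, add_sub_cancel_right]
  have hq : qNorm θ ≠ 0 := by rw [hθ]; exact one_ne_zero
  set x := r • θ
  have h1 : ∀ e ∈ boxEdges (k + 1) n,
      edgeWeight e x * ((k + 1) * c ^ k * (θ e.1 * edgeDiff F e)
        - k * c ^ (k + 1) * r⁻¹ * qGrad θ e.1 ^ (k + 1)) ≤
      edgeWeight e x * (r ^ k * |edgeDiff F e| ^ (k + 1)) := fun e _ => by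
    refine mul_le_mul_of_nonneg_left ?_ (edgeWeight_nonneg e x)
    -- The tangent point is the size of the partial derivative of `c log |x|_q` at `r θ`. Its power
    -- `d - 1` is proportional to `|θ i|`, so the linear terms add up to the radial derivative.
    have h2 := mul_pow_sub_le_pow k (s := c * r⁻¹ * qGrad θ e.1) (t := |edgeDiff F e|)
      (mul_nonneg (by positivity) (qGrad_nonneg θ e.1)) (abs_nonneg _)
    have h3 : qGrad θ e.1 ^ k = |θ e.1| := by
      have := qGrad_pow_sub_one θ hq e.1
      rwa [hθ, div_one] at this
    have h4 : θ e.1 * edgeDiff F e ≤ |θ e.1| * |edgeDiff F e| := by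
      rw [← abs_mul]; exact le_abs_self _
    calc (k + 1) * c ^ k * (θ e.1 * edgeDiff F e) - k * c ^ (k + 1) * r⁻¹ * qGrad θ e.1 ^ (k + 1)
        ≤ (k + 1) * c ^ k * (|θ e.1| * |edgeDiff F e|)
          - k * c ^ (k + 1) * r⁻¹ * qGrad θ e.1 ^ (k + 1) := by gcongr
      _ = r ^ k * ((k + 1) * (c * r⁻¹ * qGrad θ e.1) ^ k * |edgeDiff F e|
          - k * (c * r⁻¹ * qGrad θ e.1) ^ (k + 1)) := by
        rw [← h3]
        simp only [mul_pow, inv_pow]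
        field_simp
        ring
      _ ≤ _ := by gcongr
  have h5 : ∑ e ∈ boxEdges (k + 1) n, edgeWeight e x * (fun i => qGrad θ i ^ (k + 1)) e.1 ≤ 1 :=
    (sum_edgeWeight_mul_le n x _ fun i => pow_nonneg (qGrad_nonneg θ i) _).trans_eq
      (sum_qGrad_pow θ hq)
  calc (k + 1) * c ^ k * rayDeriv n F θ r - k * c ^ (k + 1) * r⁻¹
      ≤ (k + 1) * c ^ k * rayDeriv n F θ r - k * c ^ (k + 1) * r⁻¹ *
        ∑ e ∈ boxEdges (k + 1) n, edgeWeight e x * (fun i => qGrad θ i ^ (k + 1)) e.1 := by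
        have : 0 ≤ k * c ^ (k + 1) * r⁻¹ := by positivity
        nlinarith
    _ = ∑ e ∈ boxEdges (k + 1) n, edgeWeight e x * ((k + 1) * c ^ k * (θ e.1 * edgeDiff F e)
        - k * c ^ (k + 1) * r⁻¹ * qGrad θ e.1 ^ (k + 1)) := by
        rw [rayDeriv, Finset.mul_sum, Finset.mul_sum, ← Finset.sum_sub_distrib]
        exact Finset.sum_congr rfl fun e _ => by ring
    _ ≤ _ := Finset.sum_le_sum h1
    _ = r ^ k * energyDensity n F x := by
        rw [energyDensity, Finset.mul_sum]
        exact Finset.sum_congr rfl fun e _ => by ring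

theorem le_integral_ray {n : ℕ} (hn : 1 ≤ n) {F : (Fin d → ℤ) → ℝ} (h0 : F 0 = 0)
    (h1 : ∀ z : Fin d → ℤ, ‖z‖ = n → 1 ≤ F z) {K ε : ℝ} (hK0 : 0 ≤ K)
    (hK : ∀ e ∈ boxEdges d n, |edgeDiff F e| ≤ K) (hε : 0 < ε) (hε1 : ε < 1)
    (hδ : ε * (d * K) ≤ 1) {θ : Fin d → ℝ} (hθ : qNorm θ = 1) :
    (1 - ε * (d * K)) ^ d / Real.log (d * n / ε) ^ (d - 1) ≤
      ∫ r in ε..(n / ‖θ‖), r ^ (d - 1) * energyDensity n F (r • θ) := by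
  have hn' : (1 : ℝ) ≤ n := by exact_mod_cast hn
  have hd' : (1 : ℝ) ≤ d := by exact_mod_cast NeZero.pos d
  have hθ1 : ‖θ‖ ≤ 1 := (norm_le_qNorm θ).trans hθ.le
  have hθd : 1 ≤ d * ‖θ‖ := hθ.ge.trans (qNorm_le θ)
  have hθ0 : 0 < ‖θ‖ := by
    by_contra hc
    have : ‖θ‖ = 0 := le_antisymm (not_lt.1 hc) (norm_nonneg _)
    rw [this] at hθd; linarith
  set R : ℝ := n / ‖θ‖ with hR
  have hR1 : 1 ≤ R := (one_le_div hθ0).2 (hθ1.trans hn')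
  have hεR : ε ≤ R := by linarith
  have hRd : R ≤ d * n := by
    rw [hR, div_le_iff₀ hθ0]; nlinarith
  set L := Real.log (d * n / ε) with hL
  have hL0 : 0 < L := Real.log_pos ((one_lt_div hε).2 (by nlinarith))
  set δ := ε * (d * K) with hδ'
  have hint : ∀ a b, IntervalIntegrable (rayDeriv n F θ) volume a b := fun a b =>
    intervalIntegrable_of_bounded (measurable_rayDeriv n F θ) (abs_rayDeriv_le hθ hK0 hK) a b
  have hbd : 1 ≤ interp n F (R • θ) := by
    obtain ⟨i, hi⟩ := Finite.exists_max fun i => |θ i|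
    have hi' : |θ i| = ‖θ‖ := le_antisymm (norm_le_pi_norm θ i)
      ((pi_norm_le_iff_of_nonneg (abs_nonneg _)).2 hi)
    have hRθ : R * ‖θ‖ = n := div_mul_cancel₀ _ hθ0.ne'
    refine one_le_interp h1 (fun j => ?_) (i := i) ?_
    · rw [Pi.smul_apply, smul_eq_mul, abs_mul, abs_of_pos (by linarith), ← hRθ]
      exact mul_le_mul_of_nonneg_left (norm_le_pi_norm θ j) (by linarith)
    · rw [Pi.smul_apply, smul_eq_mul, abs_mul, abs_of_pos (by linarith), hi', hRθ]
  have hFTC := integral_rayDeriv hθ hK0 hK (n := n) (F := F)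
  rw [interp_zero n h0, ← hR, ← intervalIntegral.integral_add_adjacent_intervals (hint 0 ε) (hint ε R)]
    at hFTC
  have hsmall : ∫ r in (0 : ℝ)..ε, rayDeriv n F θ r ≤ δ := by
    refine (le_abs_self _).trans ?_
    have := intervalIntegral.norm_integral_le_of_norm_le_const (a := 0) (b := ε)
      (f := rayDeriv n F θ) (C := d * K) fun r _ => abs_rayDeriv_le hθ hK0 hK r
    rw [sub_zero, abs_of_pos hε] at this
    rw [hδ', mul_comm]
    exact this
  have hmain : 1 - δ ≤ ∫ r in ε..R, rayDeriv n F θ r := by linarith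
  -- For `d ≥ 2` this `c` maximises `d c^(d-1) (1 - δ) - (d-1) c^d L`, with maximum `(1 - δ)^d /
  -- L^(d-1)`.
  set c := (1 - δ) / L with hc
  have hc0 : 0 ≤ c := div_nonneg (by linarith) hL0.le
  have hcL : c * L = 1 - δ := div_mul_cancel₀ _ hL0.ne'
  have hinv : IntervalIntegrable (fun r : ℝ => r⁻¹) volume ε R := by
    refine intervalIntegral.intervalIntegrable_inv (fun r hr => ?_) continuousOn_id
    rw [Set.uIcc_of_le hεR] at hr
    exact (hε.trans_le hr.1).ne'
  have hinv' : ∫ r in ε..R, r⁻¹ ≤ L := by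
    rw [integral_inv_of_pos hε (by linarith)]
    exact Real.log_le_log (by positivity) (by gcongr)
  have hd1 : (0 : ℝ) ≤ d - 1 := by linarith
  calc (1 - δ) ^ d / L ^ (d - 1) = c ^ (d - 1) * (1 - δ) := by
        rw [hc, div_pow, div_mul_eq_mul_div, ← pow_succ, Nat.sub_add_cancel (NeZero.pos d)]
    _ = d * c ^ (d - 1) * (1 - δ) - (d - 1) * c ^ d * L := by
        have : c ^ d = c ^ (d - 1) * c := by rw [← pow_succ, Nat.sub_add_cancel (NeZero.pos d)]
        rw [this, mul_assoc (d - 1 : ℝ), mul_assoc (c ^ (d - 1)), hcL]; ring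
    _ ≤ d * c ^ (d - 1) * (∫ r in ε..R, rayDeriv n F θ r)
        - (d - 1) * c ^ d * ∫ r in ε..R, r⁻¹ := by gcongr
    _ = ∫ r in ε..R, (d * c ^ (d - 1) * rayDeriv n F θ r - (d - 1) * c ^ d * r⁻¹) := by
        rw [intervalIntegral.integral_sub ((hint ε R).const_mul _) (hinv.const_mul _),
          intervalIntegral.integral_const_mul, intervalIntegral.integral_const_mul]
    _ ≤ _ := by
        refine intervalIntegral.integral_mono_on hεR
          (((hint ε R).const_mul _).sub (hinv.const_mul _)) ?_ fun r hr =>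
            le_energyDensity_smul F hθ hc0 (hε.trans_le hr.1)
        exact intervalIntegrable_energyDensity_smul hK0 hK θ ε R

/-- The bound on a ray does not depend on the direction, so integrating it over the sphere just
multiplies it by the total mass. -/
theorem sphereVol_mul_le_energy {n : ℕ} (hn : 1 ≤ n) {F : (Fin d → ℤ) → ℝ} (h0 : F 0 = 0)
    (h1 : ∀ z : Fin d → ℤ, ‖z‖ = n → 1 ≤ F z) {K ε : ℝ} (hK0 : 0 ≤ K)
    (hK : ∀ e ∈ boxEdges d n, |edgeDiff F e| ≤ K) (hε : 0 < ε) (hε1 : ε < 1)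
    (hδ : ε * (d * K) ≤ 1) :
    (1 - ε * (d * K)) ^ d / Real.log (d * n / ε) ^ (d - 1) * sphereVol d ≤
      ∑ e ∈ boxEdges d n, |edgeDiff F e| ^ d := by
  have hE : 0 ≤ ∑ e ∈ boxEdges d n, |edgeDiff F e| ^ d := Finset.sum_nonneg fun e _ => by positivity
  set B := (1 - ε * (d * K)) ^ d / Real.log (d * n / ε) ^ (d - 1) with hB
  have hn' : (1 : ℝ) ≤ n := by exact_mod_cast hn
  have hd' : (1 : ℝ) ≤ d := by exact_mod_cast NeZero.pos d
  have hB0 : 0 ≤ B := div_nonneg (pow_nonneg (by linarith) _)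
    (pow_nonneg (Real.log_nonneg ((one_le_div hε).2 (by nlinarith))) _)
  rw [← ENNReal.ofReal_le_ofReal_iff hE, ← lintegral_energyDensity, ENNReal.ofReal_mul hB0,
    ofReal_sphereVol, lintegral_eq_lintegral_sphere (measurable_energyDensity n F).ennreal_ofReal,
    ← lintegral_const]
  refine lintegral_mono fun θ => ?_
  have hθ : qNorm (θ : LqSpace d).ofLp = 1 := norm_eq_of_mem_sphere θ
  set t := (θ : LqSpace d).ofLp
  have hθ0 : 0 < ‖t‖ := by
    by_contra hc
    have h2 : ‖t‖ = 0 := le_antisymm (not_lt.1 hc) (norm_nonneg _)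
    have := hθ.ge.trans (qNorm_le t)
    rw [h2] at this; linarith
  have hεR : ε ≤ n / ‖t‖ := by
    rw [le_div_iff₀ hθ0]
    nlinarith [(norm_le_qNorm t).trans hθ.le]
  refine (ENNReal.ofReal_le_ofReal (le_integral_ray hn h0 h1 hK0 hK hε hε1 hδ hθ)).trans ?_
  rw [intervalIntegral.integral_of_le hεR]
  calc _ ≤ ∫⁻ r in Set.Ioc ε (n / ‖t‖), ENNReal.ofReal (r ^ (d - 1) * energyDensity n F (r • t)) := by
        refine (ofReal_integral_eq_lintegral_ofReal ?_ ?_).le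
        · exact (intervalIntegrable_energyDensity_smul hK0 hK t ε (n / ‖t‖)).1
        · refine (ae_restrict_mem measurableSet_Ioc).mono fun r hr => ?_
          exact mul_nonneg (pow_nonneg (hε.trans hr.1).le _) (energyDensity_nonneg n F _)
    _ ≤ ∫⁻ r in Set.Ioi 0, ENNReal.ofReal (r ^ (d - 1) * energyDensity n F (r • t)) :=
        lintegral_mono_set fun r hr => hε.trans hr.1
    _ = _ := by
        refine setLIntegral_congr_fun measurableSet_Ioi fun r hr => ?_
        exact ENNReal.ofReal_mul (pow_nonneg (le_of_lt hr) _)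
end

/-! ### Upper bound: averaging over unit cubes -/

/-- Jensen's inequality for powers, in terms of the Lebesgue integral. -/
theorem enorm_integral_pow_le {α : Type*} [MeasurableSpace α] {μ : Measure α}
    [IsProbabilityMeasure μ] {g : α → ℝ} (hg : AEStronglyMeasurable g μ) {d : ℕ} (hd : d ≠ 0) :
    ‖∫ x, g x ∂μ‖ₑ ^ d ≤ ∫⁻ x, ‖g x‖ₑ ^ d ∂μ := by
  have hd1 : (1 : ℝ) ≤ d := by exact_mod_cast Nat.one_le_iff_ne_zero.2 hd
  have h := eLpNorm'_le_eLpNorm'_of_exponent_le (p := 1) (q := d) one_pos hd1 μ hg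
  simp only [eLpNorm', ENNReal.rpow_one, ENNReal.rpow_natCast, one_div] at h
  calc ‖∫ x, g x ∂μ‖ₑ ^ d ≤ (∫⁻ x, ‖g x‖ₑ ∂μ) ^ d := by
        gcongr
        exact enorm_integral_le_lintegral_enorm g
    _ ≤ ((∫⁻ x, ‖g x‖ₑ ^ d ∂μ) ^ (d : ℝ)⁻¹) ^ d := by
        gcongr
        simpa using h
    _ = _ := ENNReal.rpow_inv_natCast_pow hd _

section
variable {d : ℕ}

/-- The unit cube `[0, 1)^d`. -/
def unitCube (d : ℕ) : Set (Fin d → ℝ) := Set.univ.pi fun _ => Set.Ico 0 1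

theorem measurableSet_unitCube : MeasurableSet (unitCube d) :=
  MeasurableSet.univ_pi fun _ => measurableSet_Ico

theorem volume_unitCube : volume (unitCube d) = 1 := by
  rw [unitCube, Real.volume_pi_Ico]; simp

instance : IsProbabilityMeasure (volume.restrict (unitCube d)) :=
  ⟨by rw [Measure.restrict_apply_univ, volume_unitCube]⟩

theorem norm_le_one_of_mem_unitCube {v : Fin d → ℝ} (hv : v ∈ unitCube d) : ‖v‖ ≤ 1 :=
  (pi_norm_le_iff_of_nonneg zero_le_one).2 fun i => by
    have := hv i (Set.mem_univ i)
    rw [Real.norm_eq_abs, abs_of_nonneg this.1]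
    exact this.2.le

/-- The real point with the given integer coordinates. -/
def toRealPoint (z : Fin d → ℤ) : Fin d → ℝ := fun i => z i

/-- The translated half-open cubes are disjoint: coordinatewise floors recover the corner. -/
theorem sum_setLIntegral_unitCube_le (s : Finset (Fin d → ℤ)) {G : (Fin d → ℝ) → ENNReal} :
    ∑ z ∈ s, ∫⁻ v in unitCube d, G (toRealPoint z + v) ≤ ∫⁻ y, G y := by
  have h : ∀ z : Fin d → ℤ, ∫⁻ v in unitCube d, G (toRealPoint z + v) =
      ∫⁻ y in (fun y => -toRealPoint z + y) ⁻¹' unitCube d, G y := fun z => by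
    rw [← lintegral_indicator measurableSet_unitCube, ← lintegral_indicator
      (measurableSet_unitCube.preimage (by fun_prop))]
    refine Eq.trans (lintegral_congr fun v => ?_) (lintegral_add_left_eq_self
      (((fun y => -toRealPoint z + y) ⁻¹' unitCube d).indicator G) (toRealPoint z))
    have hm : toRealPoint z + v ∈ (fun y => -toRealPoint z + y) ⁻¹' unitCube d ↔ v ∈ unitCube d := by
      rw [Set.mem_preimage, neg_add_cancel_left]
    by_cases hv : v ∈ unitCube d
    · rw [Set.indicator_of_mem hv, Set.indicator_of_mem (hm.2 hv)]
    · rw [Set.indicator_of_notMem hv, Set.indicator_of_notMem (mt hm.1 hv)]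
  simp only [h]
  rw [← lintegral_biUnion_finset]
  · exact setLIntegral_le_lintegral _ _
  · intro z _ z' _ hzz
    refine Set.disjoint_left.2 fun y hy hy' => hzz (funext fun i => ?_)
    have h1 := hy i (Set.mem_univ i)
    have h2 := hy' i (Set.mem_univ i)
    simp only [Pi.add_apply, Pi.neg_apply, toRealPoint, Set.mem_Ico] at h1 h2
    have e1 : ⌊y i⌋ = z i := Int.floor_eq_iff.2 ⟨by linarith, by linarith⟩
    have e2 : ⌊y i⌋ = z' i := Int.floor_eq_iff.2 ⟨by linarith, by linarith⟩
    exact e1.symm.trans e2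
  · exact fun z _ => measurableSet_unitCube.preimage (by fun_prop)

/-- The average of `u` over the unit cube with lower corner `z`. -/
noncomputable def cubeAverage (u : (Fin d → ℝ) → ℝ) (z : Fin d → ℤ) : ℝ :=
  ∫ v in unitCube d, u (toRealPoint z + v)

theorem edgeDiff_cubeAverage {u : (Fin d → ℝ) → ℝ} (hu : Measurable u) {C : ℝ}
    (hC : ∀ y, ‖u y‖ ≤ C) (i : Fin d) (z : Fin d → ℤ) :
    edgeDiff (cubeAverage u) (i, z) = ∫ v in unitCube d,
      (u (toRealPoint z + v + Pi.single i 1) - u (toRealPoint z + v)) := by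
  have hint : ∀ w, Integrable (fun v => u (w + v)) (volume.restrict (unitCube d)) := fun w =>
    Integrable.of_bound (hu.comp (measurable_const_add w)).aestronglyMeasurable C
      (Eventually.of_forall fun v => hC _)
  have e1 : ∀ v, toRealPoint z + v + Pi.single i 1 = toRealPoint (z + Pi.single i 1) + v :=
    fun v => by
      ext j
      by_cases hj : j = i
      · subst hj; simp [toRealPoint]; ring
      · simp [toRealPoint, Pi.single_eq_of_ne hj]
  simp only [e1]
  rw [integral_sub (hint _) (hint _)]
  rfl

theorem enorm_edgeDiff_cubeAverage_pow_le (hd : d ≠ 0) {u : (Fin d → ℝ) → ℝ} (hu : Measurable u)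
    {C : ℝ} (hC : ∀ y, ‖u y‖ ≤ C) (i : Fin d) (z : Fin d → ℤ) :
    ‖edgeDiff (cubeAverage u) (i, z)‖ₑ ^ d ≤
      ∫⁻ v in unitCube d, (fun y => ‖u (y + Pi.single i 1) - u y‖ₑ ^ d) (toRealPoint z + v) := by
  rw [edgeDiff_cubeAverage hu hC]
  have hm : Measurable fun y => u (y + Pi.single i 1) - u y :=
    (hu.comp (measurable_add_const _)).sub hu
  exact enorm_integral_pow_le (hm.comp (measurable_const_add (toRealPoint z))).aestronglyMeasurable
    hd

theorem measurable_add_single (i : Fin d) :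
    Measurable fun p : (Fin d → ℝ) × ℝ => p.1 + Pi.single i p.2 :=
  (continuous_fst.add ((continuous_single i).comp continuous_snd)).measurable

theorem enorm_intervalIntegral_pow_le (hd : d ≠ 0) {D : (Fin d → ℝ) → ℝ} (hD : Measurable D)
    (i : Fin d) (y : Fin d → ℝ) :
    ‖∫ t in (0 : ℝ)..1, D (y + Pi.single i t)‖ₑ ^ d ≤
      ∫⁻ t in Set.Ioc (0 : ℝ) 1, ‖D (y + Pi.single i t)‖ₑ ^ d := by
  have hprob : IsProbabilityMeasure (volume.restrict (Set.Ioc (0 : ℝ) 1)) := ⟨by simp⟩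
  rw [intervalIntegral.integral_of_le zero_le_one]
  have hm : Measurable fun t : ℝ => D (y + Pi.single i t) :=
    hD.comp ((measurable_add_single i).comp measurable_prodMk_left)
  exact enorm_integral_pow_le hm.aestronglyMeasurable hd

/-- By Tonelli and translation invariance, averaging over unit segments preserves the integral.
Combined with Jensen on cubes and on segments, it leaves the continuum energy without any constant.
-/
theorem lintegral_lintegral_add_single {g : (Fin d → ℝ) → ENNReal} (hg : Measurable g)
    (i : Fin d) : ∫⁻ y, ∫⁻ t in Set.Ioc (0 : ℝ) 1, g (y + (Pi.single i t : Fin d → ℝ)) = ∫⁻ y, g y := by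
  have hm : Measurable (Function.uncurry fun (y : Fin d → ℝ) (t : ℝ) => g (y + Pi.single i t)) :=
    hg.comp (measurable_add_single i)
  rw [lintegral_lintegral_swap hm.aemeasurable]
  simp only [lintegral_add_right_eq_self g, lintegral_const, Measure.restrict_apply_univ,
    Real.volume_Ioc, sub_zero, ENNReal.ofReal_one, mul_one]

/-- The energy of the cube averages of a function is at most its energy on `ℝ^d`. -/
theorem sum_enorm_edgeDiff_cubeAverage_le (hd : d ≠ 0) (n : ℕ) {u : (Fin d → ℝ) → ℝ}
    {D : Fin d → (Fin d → ℝ) → ℝ} (hu : Measurable u) {C : ℝ} (hC : ∀ y, ‖u y‖ ≤ C)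
    (hD : ∀ i, Measurable (D i))
    (hFTC : ∀ i y, u (y + Pi.single i 1) - u y = ∫ t in (0 : ℝ)..1, D i (y + Pi.single i t)) :
    ∑ e ∈ boxEdges d n, ‖edgeDiff (cubeAverage u) e‖ₑ ^ d ≤ ∑ i, ∫⁻ y, ‖D i y‖ₑ ^ d := by
  rw [sum_boxEdges_eq]
  refine Finset.sum_le_sum fun i _ => ?_
  have h : ∀ y, ‖u (y + Pi.single i 1) - u y‖ₑ ^ d ≤
      ∫⁻ t in Set.Ioc (0 : ℝ) 1, ‖D i (y + Pi.single i t)‖ₑ ^ d := fun y => by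
    rw [hFTC i y]
    exact enorm_intervalIntegral_pow_le hd (hD i) i y
  have h2 := sum_setLIntegral_unitCube_le
    ((boxFinset d n).filter fun z => z + Pi.single i 1 ∈ boxFinset d n)
    (G := fun y => ‖u (y + Pi.single i 1) - u y‖ₑ ^ d)
  have h3 := lintegral_lintegral_add_single (g := fun y => ‖D i y‖ₑ ^ d)
    ((hD i).enorm.pow_const d) i
  have h1 : ∀ z, ‖edgeDiff (cubeAverage u) (i, z)‖ₑ ^ d ≤
      ∫⁻ v in unitCube d, ‖u (toRealPoint z + v + Pi.single i 1) - u (toRealPoint z + v)‖ₑ ^ d :=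
    enorm_edgeDiff_cubeAverage_pow_le hd hu hC i
  refine (Finset.sum_le_sum fun z _ => h1 z).trans (h2.trans ((lintegral_mono h).trans ?_))
  exact le_of_eq h3
variable [NeZero d]

/-! ### Upper bound: energy of the logarithmic profile -/

/-- The logarithmic profile: `0` for `|y|_q ≤ a`, `1` for `|y|_q ≥ b`, and affine in `log |y|_q`
in between. -/
noncomputable def logProfile (a b : ℝ) (y : Fin d → ℝ) : ℝ :=
  Real.log (max a (min b (qNorm y)) / a) / Real.log (b / a)

/-- The partial derivatives of the logarithmic profile. -/
noncomputable def logProfileGrad (a b : ℝ) (i : Fin d) (y : Fin d → ℝ) : ℝ :=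
  if a < qNorm y ∧ qNorm y < b then
    SignType.sign (y i) * qGrad y i / qNorm y / Real.log (b / a) else 0

theorem qGrad_le_one (y : Fin d → ℝ) (i : Fin d) : qGrad y i ≤ 1 := by
  have hd' : (1 : ℝ) ≤ d := by exact_mod_cast NeZero.pos d
  exact Real.rpow_le_one (div_nonneg (abs_nonneg _) (qNorm_nonneg _))
    (div_le_one_of_le₀ (abs_le_qNorm y i) (qNorm_nonneg _)) (one_div_nonneg.2 (by linarith))

theorem measurable_qGrad (i : Fin d) : Measurable fun y : Fin d → ℝ => qGrad y i := by
  unfold qGrad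
  have := (continuous_qNorm (d := d)).measurable
  fun_prop

theorem measurable_logProfileGrad (a b : ℝ) (i : Fin d) :
    Measurable (logProfileGrad (d := d) a b i) := by
  have h1 := (continuous_qNorm (d := d)).measurable
  have h2 := measurable_qGrad (d := d) i
  have h3 : Measurable fun y : Fin d → ℝ => ((SignType.sign (y i) : SignType) : ℝ) := by
    have : (fun y : Fin d → ℝ => ((SignType.sign (y i) : SignType) : ℝ)) =
        fun y => if 0 < y i then 1 else if y i < 0 then -1 else 0 := by
      ext y
      rw [sign_apply]
      split_ifs <;> simp
    rw [this]
    refine Measurable.ite (measurableSet_lt measurable_const (measurable_pi_apply i))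
      measurable_const (Measurable.ite (measurableSet_lt (measurable_pi_apply i) measurable_const)
        measurable_const measurable_const)
  refine Measurable.ite ((measurableSet_lt measurable_const h1).inter
    (measurableSet_lt h1 measurable_const)) ?_ measurable_const
  exact ((h3.mul h2).div h1).div_const _

theorem abs_sign_le_one (t : ℝ) : |((SignType.sign t : SignType) : ℝ)| ≤ 1 := by
  rcases lt_trichotomy t 0 with h | h | h <;> simp [h]

theorem abs_logProfileGrad_le {a b : ℝ} (ha : 0 < a) (hab : a < b) (i : Fin d) (y : Fin d → ℝ) :
    |logProfileGrad a b i y| ≤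
      if a < qNorm y ∧ qNorm y < b then qGrad y i / (qNorm y * Real.log (b / a)) else 0 := by
  have hL : 0 < Real.log (b / a) := Real.log_pos ((one_lt_div ha).2 hab)
  unfold logProfileGrad
  split_ifs with h
  · rw [abs_div, abs_div, abs_mul, abs_of_nonneg (qGrad_nonneg y i), abs_of_pos hL,
      abs_of_nonneg (qNorm_nonneg y), div_div]
    have : 0 < qNorm y := ha.trans h.1
    gcongr
    exact mul_le_of_le_one_left (qGrad_nonneg y i) (abs_sign_le_one _)
  · simp

theorem continuous_logProfile {a b : ℝ} (ha : 0 < a) :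
    Continuous (logProfile (d := d) a b) := by
  have h := continuous_qNorm (d := d)
  refine Continuous.div_const (Continuous.log (by fun_prop) fun y => ?_) _
  exact (div_pos (lt_max_of_lt_left ha) ha).ne'

omit [NeZero d] in
theorem logProfile_nonneg {a b : ℝ} (ha : 0 < a) (hab : a < b) (y : Fin d → ℝ) :
    0 ≤ logProfile a b y :=
  div_nonneg (Real.log_nonneg ((one_le_div ha).2 (le_max_left _ _)))
    (Real.log_nonneg ((one_le_div ha).2 hab.le))

omit [NeZero d] in
theorem logProfile_le_one {a b : ℝ} (ha : 0 < a) (hab : a < b) (y : Fin d → ℝ) :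
    logProfile a b y ≤ 1 := by
  have hL : 0 < Real.log (b / a) := Real.log_pos ((one_lt_div ha).2 hab)
  rw [logProfile, div_le_one hL]
  refine Real.log_le_log (div_pos (lt_max_of_lt_left ha) ha) ?_
  gcongr
  exact max_le hab.le (min_le_left _ _)

omit [NeZero d] in
theorem logProfile_of_le {a b : ℝ} (ha : 0 < a) {y : Fin d → ℝ}
    (hy : qNorm y ≤ a) : logProfile a b y = 0 := by
  rw [logProfile, max_eq_left ((min_le_right _ _).trans hy), div_self ha.ne', Real.log_one, zero_div]

omit [NeZero d] in
theorem logProfile_of_ge {a b : ℝ} (ha : 0 < a) (hab : a < b) {y : Fin d → ℝ}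
    (hy : b ≤ qNorm y) : logProfile a b y = 1 := by
  rw [logProfile, min_eq_left hy, max_eq_right hab.le, div_self]
  exact (Real.log_pos ((one_lt_div ha).2 hab)).ne'

theorem hasDerivAt_logProfile_update {a b : ℝ} (ha : 0 < a) (hab : a < b) (y : Fin d → ℝ)
    (i : Fin d) {t : ℝ} (ht : t ≠ 0) (hta : qNorm (Function.update y i t) ≠ a)
    (htb : qNorm (Function.update y i t) ≠ b) :
    HasDerivAt (fun s => logProfile a b (Function.update y i s))
      (logProfileGrad a b i (Function.update y i t)) t := by
  have hc : ContinuousAt (fun s => qNorm (Function.update y i s)) t :=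
    (hasDerivAt_qNorm_update y i ht).continuousAt
  rcases lt_or_gt_of_ne hta with h | h
  · rw [logProfileGrad, if_neg fun h' => (h'.1.trans h).false]
    refine (hasDerivAt_const t (0 : ℝ)).congr_of_eventuallyEq ?_
    filter_upwards [hc.eventually_lt continuousAt_const h] with s hs
    exact logProfile_of_le ha hs.le
  rcases lt_or_gt_of_ne htb with h' | h'
  · rw [logProfileGrad, if_pos ⟨h, h'⟩, Function.update_self]
    have h0 : qNorm (Function.update y i t) / a ≠ 0 := (div_pos (ha.trans h) ha).ne'
    have hd := (((hasDerivAt_qNorm_update y i ht).div_const a).log h0).div_const (Real.log (b / a))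
    have e : ∀ x N : ℝ, x / a / (N / a) = x / N := fun x N => div_div_div_cancel_right₀ ha.ne' x N
    rw [e] at hd
    refine hd.congr_of_eventuallyEq ?_
    filter_upwards [hc.eventually_lt continuousAt_const h',
      continuousAt_const.eventually_lt hc h] with s hs hs'
    rw [logProfile, min_eq_right hs.le, max_eq_right hs'.le]
  · rw [logProfileGrad, if_neg fun h'' => (h''.2.trans h').false]
    refine (hasDerivAt_const t (1 : ℝ)).congr_of_eventuallyEq ?_
    filter_upwards [continuousAt_const.eventually_lt hc h'] with s hs
    exact logProfile_of_ge ha hab hs.le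

/-- A coordinate line meets a level set of the norm in at most two points, `t` and `-t`. The kinks
of the profile are thus negligible on every line, and no smoothing is needed. -/
theorem countable_qNorm_update_eq (y : Fin d → ℝ) (i : Fin d) (c : ℝ) :
    {t | qNorm (Function.update y i t) = c}.Countable := by
  rcases Set.eq_empty_or_nonempty {t | qNorm (Function.update y i t) = c} with h | ⟨t, ht⟩
  · rw [h]; exact Set.countable_empty
  · refine (Set.toFinite {t, -t}).countable.mono fun s hs => ?_
    have := abs_eq_of_qNorm_update_eq y i ((show _ = c from hs).trans (show _ = c from ht).symm)
    simpa using abs_eq_abs.1 this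

theorem logProfile_add_single_sub {a b : ℝ} (ha : 0 < a) (hab : a < b) (i : Fin d)
    (y : Fin d → ℝ) :
    logProfile a b (y + Pi.single i 1) - logProfile a b y =
      ∫ t in (0 : ℝ)..1, logProfileGrad a b i (y + Pi.single i t) := by
  have e : ∀ t : ℝ, y + Pi.single i t = Function.update y i (t + y i) := fun t => by
    ext j
    by_cases hj : j = i
    · subst hj; simp [add_comm]
    · simp [Pi.single_eq_of_ne hj, Function.update_of_ne hj]
  have hL : 0 < Real.log (b / a) := Real.log_pos ((one_lt_div ha).2 hab)
  have h0 : logProfile a b y = logProfile a b (Function.update y i (0 + y i)) := by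
    rw [← e, Pi.single_zero, add_zero]
  rw [h0]
  simp only [e]
  rw [intervalIntegral.integral_comp_add_right
    (fun t => logProfileGrad a b i (Function.update y i t)) (y i)]
  have hcu : Continuous fun t : ℝ => Function.update y i t := continuous_const.update i continuous_id
  symm
  refine integral_eq_of_hasDerivAt_off_countable_of_le
    (fun t => logProfile a b (Function.update y i t)) _ (by linarith)
    (s := {0} ∪ {t | qNorm (Function.update y i t) = a} ∪ {t | qNorm (Function.update y i t) = b})
    (((Set.countable_singleton 0).union (countable_qNorm_update_eq y i a)).union
      (countable_qNorm_update_eq y i b)) ((continuous_logProfile ha).comp hcu).continuousOn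
    (fun t ht => ?_) ?_
  · have h := ht.2
    simp only [Set.mem_union, Set.mem_singleton_iff, not_or] at h
    exact hasDerivAt_logProfile_update ha hab y i h.1.1 h.1.2 h.2
  · refine intervalIntegrable_of_bounded (C := 1 / (a * Real.log (b / a)))
      ((measurable_logProfileGrad a b i).comp hcu.measurable) (fun t => ?_) _ _
    refine (abs_logProfileGrad_le ha hab i _).trans ?_
    split_ifs with h
    · have := h.1
      gcongr
      exact qGrad_le_one _ _
    · positivity

/-- On the shell the `d`-th powers of the partial derivatives sum to `(|y|_q L)^(-d)`. In polar
coordinates `r^(d-1) r^(-d) = 1 / r` integrates to `L`, leaving `L / L^d` per unit of sphere mass.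
-/
theorem sum_lintegral_logProfileGrad_le {a b : ℝ} (ha : 0 < a) (hab : a < b) :
    ∑ i : Fin d, ∫⁻ y, ‖logProfileGrad a b i y‖ₑ ^ d ≤
      ENNReal.ofReal (sphereVol d / Real.log (b / a) ^ (d - 1)) := by
  have hL : 0 < Real.log (b / a) := Real.log_pos ((one_lt_div ha).2 hab)
  set L := Real.log (b / a) with hLdef
  set H : ℝ → ENNReal := (Set.Ioo a b).indicator fun r => ENNReal.ofReal ((r * L)⁻¹ ^ d) with hH
  have hHm : Measurable H := Measurable.indicator (by fun_prop) measurableSet_Ioo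
  have hqm := (continuous_qNorm (d := d)).measurable
  rw [← lintegral_finsetSum _ fun i _ => (measurable_logProfileGrad a b i).enorm.pow_const d]
  calc ∫⁻ y, ∑ i : Fin d, ‖logProfileGrad a b i y‖ₑ ^ d
      ≤ ∫⁻ y : Fin d → ℝ, H (qNorm y) := by
        refine lintegral_mono fun y => ?_
        simp only [hH, Set.indicator_apply, Set.mem_Ioo]
        have h1 : ∀ i, ‖logProfileGrad a b i y‖ₑ ^ d = ENNReal.ofReal (|logProfileGrad a b i y| ^ d) :=
          fun i => by rw [Real.enorm_eq_ofReal_abs, ENNReal.ofReal_pow (abs_nonneg _)]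
        simp only [h1]
        rw [← ENNReal.ofReal_sum_of_nonneg fun i _ => by positivity]
        split_ifs with h
        · have hN : 0 < qNorm y := ha.trans h.1
          refine ENNReal.ofReal_le_ofReal ?_
          calc ∑ i, |logProfileGrad a b i y| ^ d ≤ ∑ i, (qGrad y i / (qNorm y * L)) ^ d := by
                refine Finset.sum_le_sum fun i _ => pow_le_pow_left₀ (abs_nonneg _) ?_ d
                have := abs_logProfileGrad_le ha hab i y
                rwa [if_pos h] at this
            _ = (qNorm y * L)⁻¹ ^ d := by
                simp only [div_eq_mul_inv, mul_pow]
                rw [← Finset.sum_mul, sum_qGrad_pow y hN.ne', one_mul]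
        · have : ∀ i, logProfileGrad a b i y = 0 := fun i => if_neg h
          simp [this, NeZero.ne d]
    _ = ∫⁻ _θ, ENNReal.ofReal (L / L ^ d) ∂sphereMeasure d := by
        rw [lintegral_eq_lintegral_sphere (h := fun y => H (qNorm y)) (hHm.comp hqm)]
        refine lintegral_congr fun θ => ?_
        have hθ : qNorm (θ : LqSpace d).ofLp = 1 := norm_eq_of_mem_sphere θ
        have e1 : ∫⁻ r in Set.Ioi (0 : ℝ), ENNReal.ofReal (r ^ (d - 1)) *
            H (qNorm (r • (θ : LqSpace d).ofLp)) =
            ∫⁻ r in Set.Ioi (0 : ℝ), (Set.Ioo a b).indicator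
              (fun r => ENNReal.ofReal (r⁻¹ * (L ^ d)⁻¹)) r := by
          refine setLIntegral_congr_fun measurableSet_Ioi fun r hr => ?_
          have hr0 : 0 < r := hr
          simp only [hH, Set.indicator_apply, qNorm_smul, hθ, mul_one, abs_of_pos hr0]
          split_ifs
          · rw [← ENNReal.ofReal_mul (by positivity)]
            congr 1
            have : r ^ d = r ^ (d - 1) * r := by rw [← pow_succ, Nat.sub_add_cancel (NeZero.pos d)]
            rw [inv_pow, mul_pow, this]
            field_simp
          · rw [mul_zero]
        have hmeas : MeasurableSet (Set.Ioo a b) := measurableSet_Ioo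
        have hinter : Set.Ioo a b ∩ Set.Ioi 0 = Set.Ioo a b :=
          Set.inter_eq_left.2 fun r hr => ha.trans hr.1
        refine e1.trans ?_
        rw [setLIntegral_indicator hmeas, hinter, Measure.restrict_congr_set Ioo_ae_eq_Ioc,
          ← ofReal_integral_eq_lintegral_ofReal, ← intervalIntegral.integral_of_le hab.le,
          intervalIntegral.integral_mul_const, integral_inv_of_pos ha (ha.trans hab), ← hLdef,
          ← div_eq_mul_inv]
        · have hi : IntervalIntegrable (fun r : ℝ => r⁻¹) volume a b := by
            refine intervalIntegral.intervalIntegrable_inv (fun r hr => ?_) continuousOn_id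
            rw [Set.uIcc_of_le hab.le] at hr
            exact (ha.trans_le hr.1).ne'
          exact (hi.mul_const _).1
        · refine (ae_restrict_mem measurableSet_Ioc).mono fun r hr => ?_
          have : 0 < r := ha.trans hr.1
          simp only [Pi.zero_apply]
          positivity
    _ = ENNReal.ofReal (sphereVol d / L ^ (d - 1)) := by
        rw [lintegral_const, ← ofReal_sphereVol, ← ENNReal.ofReal_mul (by positivity)]
        congr 1
        have : L ^ d = L ^ (d - 1) * L := by rw [← pow_succ, Nat.sub_add_cancel (NeZero.pos d)]
        rw [this]
        field_simp

theorem boxCapacity_le_sphereVol_div {n : ℕ} (hn : (d : ℝ) + 1 < n) :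
    boxCapacity d d n ≤ sphereVol d / Real.log ((n - 1) / d) ^ (d - 1) := by
  have ha : (0 : ℝ) < d := by exact_mod_cast NeZero.pos d
  have hab : (d : ℝ) < n - 1 := by linarith
  have hL : 0 < Real.log ((n - 1) / d) := Real.log_pos ((one_lt_div ha).2 hab)
  -- The unit cube at the origin lies in `|y|_q ≤ d`, and a unit cube at a boundary point lies in
  -- `|y|_∞ ≥ n - 1`. With these radii the averages take the values 0 and 1 exactly.
  set u : (Fin d → ℝ) → ℝ := logProfile d (n - 1)
  refine (boxCapacity_le (cubeAverage u) ?_ fun z hz => ?_).trans ?_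
  · refine (setIntegral_congr_fun measurableSet_unitCube fun v hv => ?_).trans
      (integral_zero _ _)
    refine logProfile_of_le ha ((qNorm_le _).trans ?_)
    have : toRealPoint (0 : Fin d → ℤ) + v = v := by ext; simp [toRealPoint]
    rw [this]
    exact mul_le_of_le_one_right ha.le (norm_le_one_of_mem_unitCube hv)
  · refine le_of_eq (Eq.symm ((setIntegral_congr_fun measurableSet_unitCube (g := fun _ => (1 : ℝ))
      fun v hv => ?_).trans (by simp [measureReal_def])))
    refine logProfile_of_ge ha hab (le_trans ?_ (norm_le_qNorm _))
    have h1 : ‖z‖ ≤ ‖toRealPoint z‖ := (pi_norm_le_iff_of_nonneg (norm_nonneg _)).2 fun i =>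
      (norm_le_pi_norm (toRealPoint z) i)
    have h2 := norm_sub_le (toRealPoint z + v) v
    rw [add_sub_cancel_right] at h2
    have h3 := norm_le_one_of_mem_unitCube hv
    linarith
  · rw [← ENNReal.ofReal_le_ofReal_iff (div_nonneg sphereVol_pos.le (by positivity)),
      ENNReal.ofReal_sum_of_nonneg fun e _ => by positivity]
    refine le_trans (le_of_eq ?_) ((sum_enorm_edgeDiff_cubeAverage_le (NeZero.ne d) n
      (continuous_logProfile ha).measurable (C := 1) (fun y => ?_) (measurable_logProfileGrad _ _)
      (logProfile_add_single_sub ha hab)).trans (sum_lintegral_logProfileGrad_le ha hab))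
    · refine Finset.sum_congr rfl fun e _ => ?_
      rw [ENNReal.ofReal_pow (abs_nonneg _), Real.enorm_eq_ofReal_abs]
      rfl
    · rw [Real.norm_eq_abs, abs_of_nonneg (logProfile_nonneg ha hab y)]
      exact logProfile_le_one ha hab y
end

/-! ### Comparison of logarithms and conclusion -/

theorem tendsto_log_div_log_mul {c : ℝ} (hc : 0 < c) :
    Tendsto (fun n : ℕ => Real.log n / Real.log (c * n)) atTop (nhds 1) := by
  have hlog : Tendsto (fun n : ℕ => Real.log n) atTop atTop :=
    Real.tendsto_log_atTop.comp tendsto_natCast_atTop_atTop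
  have h1 : Tendsto (fun n : ℕ => (Real.log c * (Real.log n)⁻¹ + 1)⁻¹) atTop (nhds 1) := by
    have := ((hlog.inv_tendsto_atTop.const_mul (Real.log c)).add_const 1).inv₀ (by simp)
    simpa using this
  refine h1.congr' ?_
  filter_upwards [hlog.eventually_gt_atTop 0, eventually_gt_atTop 0] with n hn hn0
  have hn0' : (n : ℝ) ≠ 0 := by exact_mod_cast hn0.ne'
  rw [Real.log_mul hc.ne' hn0', ← div_eq_mul_inv, div_add_one hn.ne', inv_div]

section
variable {d : ℕ} [NeZero d]

theorem sphereVol_mul_le_boxCapacity {n : ℕ} (hn : 1 ≤ n) {ε : ℝ} (hε : 0 < ε) (hε1 : ε < 1)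
    (hδ : ε * (d * (1 + sphereVol d)) ≤ 1) (hlog : 1 ≤ Real.log (d * n / ε)) :
    (1 - ε * (d * (1 + sphereVol d))) ^ d / Real.log (d * n / ε) ^ (d - 1) * sphereVol d ≤
      boxCapacity d d n := by
  have hV := sphereVol_pos (d := d)
  refine le_boxCapacity (by omega) _ fun F h0 h1 => ?_
  -- If the energy is at least the sphere mass, the bound is trivial because the logarithm is at
  -- least 1. Otherwise the energy bounds every increment by `1 + sphereVol d`, uniformly in `n` and
  -- `F`.
  by_cases hE : sphereVol d ≤ ∑ e ∈ boxEdges d n, |F (e.2 + Pi.single e.1 1) - F e.2| ^ d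
  · refine le_trans (mul_le_of_le_one_left hV.le ?_) hE
    rw [div_le_one (by positivity)]
    have : 0 ≤ ε * (d * (1 + sphereVol d)) := by positivity
    exact (pow_le_one₀ (by linarith) (by linarith)).trans (one_le_pow₀ hlog)
  · refine sphereVol_mul_le_energy hn h0 h1 (by linarith) (fun e he => ?_) hε hε1 hδ
    have h2 : |edgeDiff F e| ^ d ≤ (1 + sphereVol d) ^ d := by
      calc |edgeDiff F e| ^ d ≤ ∑ e ∈ boxEdges d n, |edgeDiff F e| ^ d :=
            Finset.single_le_sum (f := fun e => |edgeDiff F e| ^ d)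
              (fun e _ => pow_nonneg (abs_nonneg _) d) he
        _ ≤ 1 + sphereVol d := by
            have := not_le.1 hE
            simp only [edgeDiff]
            linarith
        _ ≤ (1 + sphereVol d) ^ d := le_self_pow₀ (by linarith) (NeZero.ne d)
    exact (pow_le_pow_iff_left₀ (abs_nonneg _) (by linarith) (NeZero.ne d)).1 h2

end

theorem mainTheorem1 (d : ℕ) [NeZero d] :
    (fun n : ℕ => boxCapacity d (d : ℝ) n) ~[atTop]
      (fun n : ℕ => sphereVol d / (Real.log (n : ℝ)) ^ (d - 1)) := by
  have hV := sphereVol_pos (d := d)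
  have hd0 : (0 : ℝ) < d := by exact_mod_cast NeZero.pos d
  have hlog : Tendsto (fun n : ℕ => Real.log n) atTop atTop :=
    Real.tendsto_log_atTop.comp tendsto_natCast_atTop_atTop
  have hpow : ∀ {c : ℝ}, 0 < c →
      Tendsto (fun n : ℕ => (Real.log n / Real.log (c * n)) ^ (d - 1)) atTop (nhds 1) :=
    fun hc => by simpa using (tendsto_log_div_log_mul hc).pow (d - 1)
  have hlogc : ∀ {c : ℝ}, 0 < c → Tendsto (fun n : ℕ => Real.log (c * n)) atTop atTop :=
    fun hc => Real.tendsto_log_atTop.comp (tendsto_natCast_atTop_atTop.const_mul_atTop hc)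
  rw [isEquivalent_iff_tendsto_one]
  swap
  · filter_upwards [hlog.eventually_gt_atTop 0] with n hn
    positivity
  refine tendsto_order.2 ⟨fun a ha => ?_, fun a ha => ?_⟩
  · set K : ℝ := d * (1 + sphereVol d) with hK
    have hK0 : 0 < K := by positivity
    -- The cutoff is fixed before `n`, so it costs a factor close to 1 and a constant inside the
    -- logarithm.
    obtain ⟨ε, hεa, hε0, hε1, hεK⟩ : ∃ ε : ℝ, a < (1 - ε * K) ^ d ∧ 0 < ε ∧ ε < 1 ∧ ε * K ≤ 1 := by
      have hcont : Continuous fun ε : ℝ => (1 - ε * K) ^ d := by fun_prop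
      have h1 : ∀ᶠ ε in nhdsWithin (0 : ℝ) (Set.Ioi 0), a < (1 - ε * K) ^ d :=
        (hcont.continuousAt.eventually (lt_mem_nhds (by simpa using ha))).filter_mono
          nhdsWithin_le_nhds
      have h2 : ∀ᶠ ε in nhdsWithin (0 : ℝ) (Set.Ioi 0), ε < 1 :=
        (eventually_lt_nhds one_pos).filter_mono nhdsWithin_le_nhds
      have h3 : ∀ᶠ ε in nhdsWithin (0 : ℝ) (Set.Ioi 0), ε < 1 / K :=
        (eventually_lt_nhds (by positivity)).filter_mono nhdsWithin_le_nhds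
      obtain ⟨ε, h1, h2, h3, h4⟩ := (h1.and (h2.and (h3.and self_mem_nhdsWithin))).exists
      exact ⟨ε, h1, h4, h2, ((lt_div_iff₀ hK0).1 h3).le⟩
    have hc : 0 < d / ε := by positivity
    have hlim := (hpow hc).const_mul ((1 - ε * K) ^ d)
    rw [mul_one] at hlim
    filter_upwards [hlim.eventually (lt_mem_nhds hεa), (hlogc hc).eventually_ge_atTop 1,
      hlog.eventually_gt_atTop 0, eventually_ge_atTop 1] with n h1 h2 h3 h4
    refine h1.trans_le ?_
    have e : (d : ℝ) / ε * n = d * n / ε := by ring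
    rw [e] at h2 ⊢
    have h5 := sphereVol_mul_le_boxCapacity h4 hε0 hε1 hεK h2
    rw [Pi.div_apply, le_div_iff₀ (by positivity)]
    refine le_trans (le_of_eq ?_) h5
    have h6 : 0 < Real.log (d * n / ε) := by linarith
    rw [div_pow, ← hK]
    field_simp
  -- The factor `1 / (2 d)` comes from `n - 1 ≥ n / 2`, which replaces `(n - 1) / d` by a constant
  -- multiple of `n`.
  · have hc : 0 < 1 / (2 * (d : ℝ)) := by positivity
    filter_upwards [(hpow hc).eventually (gt_mem_nhds ha), (hlogc hc).eventually_gt_atTop 0,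
      hlog.eventually_gt_atTop 0, eventually_gt_atTop (d + 1)] with n h1 h2 h3 h4
    refine lt_of_le_of_lt ?_ h1
    have h4' : (d : ℝ) + 1 < n := by exact_mod_cast h4
    have hd1 : (1 : ℝ) ≤ d := by exact_mod_cast NeZero.pos d
    rw [Pi.div_apply, div_le_iff₀ (by positivity)]
    calc boxCapacity d d n ≤ sphereVol d / Real.log ((n - 1) / d) ^ (d - 1) :=
          boxCapacity_le_sphereVol_div h4'
      _ ≤ sphereVol d / Real.log (1 / (2 * d) * n) ^ (d - 1) := by
          have h5 : Real.log (1 / (2 * d) * n) ≤ Real.log ((n - 1) / d) := by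
            have hn0 : (0 : ℝ) < n := by linarith
            refine Real.log_le_log (by positivity) ?_
            rw [one_div_mul_eq_div, div_le_div_iff₀ (by positivity) hd0]
            nlinarith
          gcongr
      _ = _ := by
          rw [div_pow]
          field_simp
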